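/- Let $\mathcal A_n=\{1<2<\dots<n\}$ ($n$ finite). For a word $w$ over $\mathcal A_n$ let ${\rm P}^{\rightarrow}(w)$ be the stalactic tableau obtained by reading $w$ from left to right and inserting each letter $a$ at the bottom of the column that contains $a$, or, if there is none, as a new column at the right end; let ${\rm P}^{\leftarrow}(w)$ be obtained by reading $w$ from right to left, with new columns added at the left end. Write $u\equiv_{\mathsf m}v$ if ${\rm P}^{\rightarrow}(u)={\rm P}^{\rightarrow}(v)$ and ${\rm P}^{\leftarrow}(u)={\rm P}^{\leftarrow}(v)$; this is a congruence, and $\mathsf{mSt}_n=\mathcal A_n^{\star}/{\equiv_{\mathsf m}}$ is the meet-stalactic monoid of rank $n$. A permutation $\sigma$ of $\mathcal A_n$ with $\sigma^2=1$ induces the involution $[a_1a_2\cdots a_k]^{\sigma}=[\sigma(a_k)\cdots\sigma(a_2)\sigma(a_1)]$ of $\mathsf{mSt}_n$. For a monoid $M$ with involution $^*$, the problem $\textsc{Check-Id}(M,{}^*)$ is: given two nonempty words $u,v$ over $\mathcal X\cup\mathcal X^*$, where $\mathcal X=\{x_0,x_1,x_2,\dots\}$ and $\mathcal X^*=\{x_0^*,x_1^*,\dots\}$,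 decide whether $\varphi(u)=\varphi(v)$ for every substitution $\varphi:\mathcal X\to M$, extended by $\varphi(x^*)=\varphi(x)^*$. The input is written as a string over a finite alphabet, with the indices of variables in binary. Then for every finite $n$, every $i\ge 0$ and every permutation $\sigma_i$ of $\mathcal A_n$ that is a product of $i$ disjoint $2$-cycles, the decision problem $\textsc{Check-Id}(\mathsf{mSt}_n,{}^{\sigma_i})$ belongs to the complexity class $\mathsf P$. This covers $\sigma_0=\mathrm{id}$ (all $n$), $\sigma_1$ ($n\ge 2$), and $\sigma_i$ with $2\le i\le\lfloor n/2\rfloor$ ($n\ge 4$). -/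

import Mathlib

namespace MeetStalactic

section Tableaux

variable {α β : Type} [DecidableEq α] [DecidableEq β]

/-- An array with top-aligned columns, given by the list of its columns from left to right, each
column being read from top to bottom. The arrays produced by the two insertion algorithms below are
the stalactic tableaux: two entries are in the same column if and only if they are equal. -/
abbrev Tableau (α : Type) : Type := List (List α)

/-- Left insertion: if `a` occurs in `T`, put it at the bottom of the column in which it occurs,
otherwise put it to the left of the top row. -/
def insertLeft (T : Tableau α) (a : α) : Tableau α :=
  if ∃ c ∈ T, a ∈ c then T.map (fun c => if a ∈ c then c ++ [a] else c) else [a] :: T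

/-- Right insertion: if `a` occurs in `T`, put it at the bottom of the column in which it occurs,
otherwise put it to the right of the top row. -/
def insertRight (T : Tableau α) (a : α) : Tableau α :=
  if ∃ c ∈ T, a ∈ c then T.map (fun c => if a ∈ c then c ++ [a] else c) else T ++ [[a]]

/-- The right-stalactic tableau of a word: read the word from right to left, inserting its letters
by left insertion. -/
def rightTableau (w : List α) : Tableau α := w.foldr (fun a T => insertLeft T a) []

/-- The left-stalactic tableau of a word: read the word from left to right, inserting its letters
by right insertion. -/
def leftTableau (w : List α) : Tableau α := w.foldl insertRight []

/-- The initial part of a word: the first occurrences of its letters, in order. -/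
def initialPart (w : List α) : List α := w.foldl (fun l a => if a ∈ l then l else l ++ [a]) []

theorem initialPart_concat (w : List α) (a : α) :
    initialPart (w ++ [a]) = if a ∈ initialPart w then initialPart w else initialPart w ++ [a] := by
  unfold initialPart
  rw [List.foldl_append]
  rfl

theorem mem_initialPart (w : List α) (a : α) : a ∈ initialPart w ↔ a ∈ w := by
  induction w using List.reverseRecOn with
  | nil => simp [initialPart]
  | append_singleton w b ih =>
    rw [initialPart_concat]
    split_ifs with h
    · simp only [ih, List.mem_append, List.mem_singleton]
      constructor
      · exact Or.inl
      · rintro (h' | rfl)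
        · exact h'
        · exact ih.1 (by simpa using h)
    · simp [ih]

theorem initialPart_append (u v : List α) :
    initialPart (u ++ v) = initialPart u ++ (initialPart v).filter (fun a => a ∉ u) := by
  induction v using List.reverseRecOn with
  | nil => simp [initialPart]
  | append_singleton v b ih =>
    rw [← List.append_assoc, initialPart_concat, initialPart_concat, ih]
    by_cases hv : b ∈ v <;> by_cases hu : b ∈ u <;> simp [mem_initialPart, hv, hu]

theorem initialPart_map (f : α → β) (hf : Function.Injective f) (w : List α) :
    initialPart (w.map f) = (initialPart w).map f := by
  induction w using List.reverseRecOn with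
  | nil => simp [initialPart]
  | append_singleton w b ih =>
    rw [List.map_append, List.map_singleton, initialPart_concat, initialPart_concat, ih]
    simp only [List.mem_map_of_injective hf]
    by_cases h : b ∈ initialPart w <;> simp [h]

theorem leftTableau_eq (w : List α) :
    leftTableau w = (initialPart w).map (fun a => List.replicate (w.count a) a) := by
  induction w using List.reverseRecOn with
  | nil => simp [initialPart, leftTableau]
  | append_singleton w b ih =>
    have h1 : leftTableau (w ++ [b]) = insertRight (leftTableau w) b := by simp [leftTableau]
    rw [h1, ih, initialPart_concat]
    have key : (∃ c ∈ (initialPart w).map (fun a => List.replicate (w.count a) a), b ∈ c) ↔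
        b ∈ initialPart w := by
      simp only [List.mem_map, exists_exists_and_eq_and, List.mem_replicate]
      constructor
      · rintro ⟨a, ha, -, rfl⟩
        exact ha
      · intro h
        refine ⟨b, h, ?_, rfl⟩
        rw [mem_initialPart] at h
        exact (List.count_pos_iff.2 h).ne'
    unfold insertRight
    by_cases h : b ∈ initialPart w
    · rw [if_pos (key.2 h), if_pos h, List.map_map]
      refine List.map_congr_left fun x hx => ?_
      rw [mem_initialPart] at hx
      have hx' : w.count x ≠ 0 := (List.count_pos_iff.2 hx).ne'
      simp only [Function.comp, List.mem_replicate, List.count_append]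
      by_cases hbx : b = x
      · subst hbx
        simp [hx', List.replicate_succ']
      · simp [hbx]
    · rw [if_neg (fun hh => h (key.1 hh)), if_neg h, List.map_append]
      congr 1
      · refine List.map_congr_left fun x hx => ?_
        have hbx : b ≠ x := fun e => h (e ▸ hx)
        simp [List.count_append, hbx]
      · rw [mem_initialPart] at h
        simp [List.count_append, List.count_eq_zero_of_not_mem h]

theorem leftTableau_eq_iff (u v : List α) :
    leftTableau u = leftTableau v ↔ initialPart u = initialPart v ∧ ∀ a, u.count a = v.count a := by
  constructor
  · intro h
    have hd : ∀ w : List α, (leftTableau w).map List.head? = (initialPart w).map some := by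
      intro w
      rw [leftTableau_eq, List.map_map]
      refine List.map_congr_left fun x hx => ?_
      rw [mem_initialPart] at hx
      simp [List.head?_replicate, (List.count_pos_iff.2 hx).ne']
    have hi : initialPart u = initialPart v :=
      (List.map_injective_iff.2 (Option.some_injective α)) (by rw [← hd, ← hd, h])
    refine ⟨hi, fun a => ?_⟩
    by_cases ha : a ∈ initialPart u
    · rw [leftTableau_eq, leftTableau_eq, ← hi, List.map_inj_left] at h
      simpa using congrArg List.length (h a ha)
    · have hb : a ∉ initialPart v := hi ▸ ha
      rw [mem_initialPart] at ha hb
      rw [List.count_eq_zero_of_not_mem ha, List.count_eq_zero_of_not_mem hb]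
  · rintro ⟨hi, hc⟩
    rw [leftTableau_eq, leftTableau_eq, hi]
    simp [hc]

theorem leftTableau_append {u u' v v' : List α} (h : leftTableau u = leftTableau u')
    (h' : leftTableau v = leftTableau v') : leftTableau (u ++ v) = leftTableau (u' ++ v') := by
  rw [leftTableau_eq_iff] at h h' ⊢
  have hm : ∀ a, a ∈ u ↔ a ∈ u' := fun a => by
    rw [← mem_initialPart, h.1, mem_initialPart]
  refine ⟨?_, fun a => by simp [h.2, h'.2]⟩
  rw [initialPart_append, initialPart_append, h.1, h'.1]
  simp [hm]

theorem leftTableau_map (f : α → β) (hf : Function.Injective f) (w : List α) :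
    leftTableau (w.map f) = (leftTableau w).map (List.map f) := by
  rw [leftTableau_eq, leftTableau_eq, initialPart_map f hf, List.map_map, List.map_map]
  refine List.map_congr_left fun x _ => ?_
  simp [List.count_map_of_injective w f hf]

theorem rightTableau_eq (w : List α) : rightTableau w = (leftTableau w.reverse).reverse := by
  induction w with
  | nil => rfl
  | cons a w ih =>
    have h1 : rightTableau (a :: w) = insertLeft (rightTableau w) a := rfl
    have h2 : leftTableau (a :: w).reverse = insertRight (leftTableau w.reverse) a := by
      simp [leftTableau]
    rw [h1, h2, ih]
    unfold insertLeft insertRight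
    simp only [List.mem_reverse]
    split_ifs <;> simp

end Tableaux

/-- The meet-stalactic congruence on the free monoid over `α`: two words are related if and only if
they have the same pair of (left-stalactic, right-stalactic) tableaux. -/
def meetCon (α : Type) [DecidableEq α] : Con (FreeMonoid α) where
  r u v := leftTableau u.toList = leftTableau v.toList ∧
    rightTableau u.toList = rightTableau v.toList
  iseqv := ⟨fun _ => ⟨rfl, rfl⟩, fun h => ⟨h.1.symm, h.2.symm⟩,
    fun h h' => ⟨h.1.trans h'.1, h.2.trans h'.2⟩⟩
  mul' := by
    rintro w x y z ⟨h1, h2⟩ ⟨h3, h4⟩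
    simp only [rightTableau_eq, List.reverse_inj] at h2 h4 ⊢
    simp only [FreeMonoid.toList_mul, List.reverse_append]
    exact ⟨leftTableau_append h1 h3, leftTableau_append h4 h2⟩

/-- The meet-stalactic monoid of rank `n`, over the alphabet `Fin n`. -/
abbrev MSt (n : ℕ) : Type := (meetCon (Fin n)).Quotient

/-- An involution of a monoid: an anti-automorphism that is its own inverse. -/
structure Involution (M : Type) [Monoid M] where
  op : M → M
  op_mul : ∀ a b, op (a * b) = op b * op a
  op_op : ∀ a, op (op a) = a

/-- `a₁ a₂ ⋯ a_k ↦ σ(a_k) ⋯ σ(a₂) σ(a₁)`. -/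
def reverseMap {α : Type} (σ : α → α) (w : FreeMonoid α) : FreeMonoid α :=
  FreeMonoid.ofList (w.toList.map σ).reverse

theorem meetCon_reverseMap {α : Type} [DecidableEq α] (σ : α → α) (hσ : Function.Injective σ)
    {u v : FreeMonoid α} (h : meetCon α u v) :
    meetCon α (reverseMap σ u) (reverseMap σ v) := by
  obtain ⟨h1, h2⟩ := h
  change leftTableau (u.toList.map σ).reverse = leftTableau (v.toList.map σ).reverse ∧
    rightTableau (u.toList.map σ).reverse = rightTableau (v.toList.map σ).reverse
  simp only [rightTableau_eq, List.reverse_inj] at h2 ⊢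
  simp only [List.reverse_reverse, ← List.map_reverse]
  rw [leftTableau_map σ hσ, leftTableau_map σ hσ, leftTableau_map σ hσ, leftTableau_map σ hσ,
    h1, h2]
  exact ⟨rfl, rfl⟩

/-- The involution of the meet-stalactic monoid of rank `n` induced by a permutation `σ` of the
alphabet with `σ² = 1`: it maps the class of `a₁ ⋯ a_k` to the class of `σ(a_k) ⋯ σ(a₁)`. -/
def involution {n : ℕ} (σ : Equiv.Perm (Fin n)) (hσ : σ * σ = 1) : Involution (MSt n) where
  op q := Con.liftOn q (fun w => ((reverseMap σ w : FreeMonoid (Fin n)) : MSt n))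
    (fun _ _ h => (Con.eq _).2 (meetCon_reverseMap σ σ.injective h))
  op_mul a b := by
    induction a using Con.induction_on with
    | _ u =>
      induction b using Con.induction_on with
      | _ v =>
        change ((reverseMap σ (u * v) : FreeMonoid (Fin n)) : MSt n) =
          ((reverseMap σ v * reverseMap σ u : FreeMonoid (Fin n)) : MSt n)
        congr 1
        apply FreeMonoid.toList.injective
        simp [reverseMap, FreeMonoid.toList_mul]
  op_op a := by
    induction a using Con.induction_on with
    | _ u =>
      change ((reverseMap σ (reverseMap σ u) : FreeMonoid (Fin n)) : MSt n) = (u : MSt n)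
      congr 1
      apply FreeMonoid.toList.injective
      have h : (σ ∘ σ : Fin n → Fin n) = id := funext fun x => Equiv.congr_fun hσ x
      simp [reverseMap, h]

/-- A permutation that is a product of `i` disjoint transpositions squares to the identity. -/
theorem mul_self_of_cycleType {n i : ℕ} {σ : Equiv.Perm (Fin n)}
    (h : σ.cycleType = Multiset.replicate i 2) : σ * σ = 1 := by
  rw [← pow_two, ← orderOf_dvd_iff_pow_eq_one, ← Equiv.Perm.lcm_cycleType, h, Multiset.lcm_dvd]
  intro b hb
  rw [Multiset.eq_of_mem_replicate hb]

/-- The alphabet `𝒳 ∪ 𝒳*` of variables, with `𝒳 = {x₀, x₁, x₂, …}`: `Sum.inl k` is the variable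
`x_k` and `Sum.inr k` is the variable `x_k*`. -/
abbrev Variable : Type := ℕ ⊕ ℕ

/-- The value of a word over `𝒳 ∪ 𝒳*` under the substitution `φ : 𝒳 → M`. -/
def evalWord {M : Type} [Monoid M] (inv : Involution M) (φ : ℕ → M) (w : List Variable) : M :=
  (w.map (Sum.elim φ (fun x => inv.op (φ x)))).prod

/-- `(M, *)` satisfies the identity `u ≈ v`. -/
def Satisfies {M : Type} [Monoid M] (inv : Involution M) (u v : List Variable) : Prop :=
  ∀ φ : ℕ → M, evalWord inv φ u = evalWord inv φ v

/-- The finite alphabet in which identities are written down. -/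
inductive Sym : Type
  | bit (b : Bool)
  | plain
  | star
  | approx

/-- A variable is written as the binary numeral of its index (least significant bit first),
followed by a mark which tells whether the variable is starred. -/
def encodeVariable : Variable → List Sym
  | Sum.inl k => k.bits.map Sym.bit ++ [Sym.plain]
  | Sum.inr k => k.bits.map Sym.bit ++ [Sym.star]

/-- The identity `u ≈ v` as a string over the finite alphabet `Sym`. -/
def encodeIdentity (u v : List Variable) : List Sym :=
  u.flatMap encodeVariable ++ [Sym.approx] ++ v.flatMap encodeVariable

/-- The identity checking problem of `(M, *)`, as a language: the strings that encode an identity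
`u ≈ v` between nonempty words over `𝒳 ∪ 𝒳*` which `(M, *)` satisfies. -/
def CheckId {M : Type} [Monoid M] (inv : Involution M) : Language Sym :=
  {s | ∃ u v : List Variable, u ≠ [] ∧ v ≠ [] ∧ s = encodeIdentity u v ∧ Satisfies inv u v}

/-- The complexity class `P` (over the alphabet `Γ`): the languages whose membership problem is
decided, on every input string, by a Turing machine within a number of steps that is bounded by a
polynomial in the length of the string. -/
def ClassP (Γ : Type) : Set (Language Γ) :=
  {L | ∃ f : List Γ → Bool, (∀ s, f s = true ↔ s ∈ L) ∧
    Nonempty (Turing.TM2ComputableInPolyTime (id : List Γ → List Γ) Computability.encodeBool f)}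

end MeetStalactic

/-! Equality in the meet-stalactic monoid means equal letter counts and equal orders of first
occurrences, for a word and for its reverse (`leftTableau_eq_iff`, `rightTableau_eq`). The order of
first occurrences is determined by the questions "which of `a`, `b` comes first?"
(`eq_of_pickFirst_eq`). This makes identity checking local.

Counts: an identity preserves them under all substitutions iff each variable occurs equally often on
both sides, where `x` and `x*` are counted together if `σ` is the identity, separately if it is not,
and not at all over the empty alphabet (`nameCount_eq_of_count`, `count_eq_of_nameCount`).

Order: the first `a` or `b` in the value of `u` comes from one variable of `u`, and similarly for
`v`. Erasing all other variables does not change either answer, so it suffices to test pairs of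
variables (`pickFirst_substWord_eq`). For a pair, a substitution matters only through the function
that assigns to each of the four labels (variable, star) the first `a` or `b` in the word put there.
There are finitely many such functions, because the alphabet is finite and fixed. Hence
`satisfies_of_pairOk` and its converse `pairOk_of_satisfies`.

Complexity: for a fixed pair, one pass over the identity with finite control and two unary counters
decides the condition. Every variable is named by the digits at the start of some suffix of the
input, so the machine runs over all pairs of suffixes; superfluous names do no harm, since a valid
identity passes for all names. This takes cubically many moves (`runsTo_checker`), and multi-stack
machines compile to Turing machines with linear overhead (`mem_classP`). -/

namespace MeetStalactic

/-! ### Stack machines and their compilation to Turing machines -/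

/-- What a stack machine does to one of its stacks in one step: nothing (`none`), deleting the top
symbol (`some none`), or pushing a symbol `a` (`some (some a)`). -/
abbrev StackAct (Γ : Type) : Type := Option (Option Γ)

def StackAct.apply {Γ : Type} : StackAct Γ → List Γ → List Γ
  | none, l => l
  | some none, l => l.tail
  | some (some a), l => a :: l

theorem StackAct.length_apply_le {Γ : Type} (A : StackAct Γ) (l : List Γ) :
    (A.apply l).length ≤ l.length + 1 := by
  rcases A with _ | _ | a <;> simp [StackAct.apply]; omega

/-- A deterministic machine with finite control `Q` and stacks indexed by `K` over one alphabet. In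
each step it reads the top symbols of all stacks, and either stops with a verdict, or changes its
state and acts on each stack. -/
structure StackMachine (K Γ Q : Type) where
  input : K
  start : Q
  next : Q → (K → Option Γ) → (Q × (K → StackAct Γ)) ⊕ Bool

namespace StackMachine

variable {K Γ Q : Type}

/-- From state `q` and stacks `S` the machine reaches the verdict `b` within `t` moves. -/
inductive RunsTo (M : StackMachine K Γ Q) : ℕ → Q → (K → List Γ) → Bool → Prop
  | halt {t : ℕ} {q : Q} {S : K → List Γ} {b : Bool}
      (h : M.next q (fun k => (S k).head?) = Sum.inr b) : RunsTo M t q S b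
  | step {t : ℕ} {q q' : Q} {S : K → List Γ} {A : K → StackAct Γ} {b : Bool}
      (h : M.next q (fun k => (S k).head?) = Sum.inl (q', A))
      (h' : RunsTo M t q' (fun k => (A k).apply (S k)) b) : RunsTo M (t + 1) q S b

theorem RunsTo.mono {M : StackMachine K Γ Q} {t t' : ℕ} {q : Q} {S : K → List Γ} {b : Bool}
    (h : M.RunsTo t q S b) (ht : t ≤ t') : M.RunsTo t' q S b := by
  induction h generalizing t' with
  | halt h => exact .halt h
  | step h _ ih =>
    obtain ⟨r, rfl⟩ := Nat.exists_eq_add_of_le' ht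
    rw [← add_assoc]
    exact .step h (ih (Nat.le_add_left _ _))

section Compile

open Turing Turing.TM2.Stmt Function

/-- The stacks of the compiled machine: those of the stack machine, and one for the verdict. -/
def StackType (K Γ : Type) : Option K → Type
  | none => Bool
  | some _ => Γ

/-- The internal states of the compiled machine: the current state of the stack machine, the symbols
read in the current move, and the result of the transition function. -/
abbrev Store (K Γ Q : Type) : Type :=
  Q × (K → Option Γ) × ((Q × (K → StackAct Γ)) ⊕ Bool)

abbrev Code (K Γ Q : Type) : Type := TM2.Stmt (StackType K Γ) Bool (Store K Γ Q)

def content (S : K → List Γ) (o : List Bool) : ∀ k : Option K, List (StackType K Γ k)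
  | none => o
  | some k => S k

variable [DecidableEq K]

theorem update_content (S : K → List Γ) (o : List Bool) (k : K) (l : List Γ) :
    update (content S o) (some k) l = content (update S k l) o := by
  funext j
  cases j with
  | none => rfl
  | some j =>
    by_cases h : j = k
    · subst h
      exact (update_self _ _ _).trans (update_self j l S).symm
    · exact (update_of_ne (fun e => h (Option.some.inj e)) _ _).trans
        (show S j = update S k l j from (update_of_ne h l S).symm)

/-- A `TM2` step executes a statement up to the next `goto` or `halt`, so visiting all stacks still
costs a single step. -/
def readAll (ks : List K) (r : Code K Γ Q) : Code K Γ Q :=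
  ks.foldr (fun k r => peek (some k) (fun v c => (v.1, update v.2.1 k c, v.2.2)) r) r

def popAll (ks : List K) (r : Code K Γ Q) : Code K Γ Q :=
  ks.foldr (fun k r => pop (some k) (fun v c => (v.1, update v.2.1 k c, v.2.2)) r) r

def actOf (v : Store K Γ Q) (k : K) : StackAct Γ :=
  v.2.2.elim (fun x => x.2 k) (fun _ => none)

/-- The value `default` is never pushed: the inner branch guarantees that there is a symbol. -/
def actAll [Inhabited Γ] (ks : List K) (r : Code K Γ Q) : Code K Γ Q :=
  ks.foldr (fun k r =>
    branch (fun v => (actOf v k).isSome)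
      (branch (fun v => (actOf v k).join.isSome)
        (push (some k) (fun v => ((actOf v k).join.getD default : Γ)) r)
        (pop (some k) (fun v _ => v) r)) r) r

theorem stepAux_readAll (r : Code K Γ Q) (ks : List K) (v : Store K Γ Q) (S : K → List Γ)
    (o : List Bool) :
    TM2.stepAux (readAll ks r) v (content S o) =
      TM2.stepAux r (v.1, fun k => if k ∈ ks then (S k).head? else v.2.1 k, v.2.2)
        (content S o) := by
  induction ks generalizing v with
  | nil => simp [readAll]
  | cons k ks ih =>
    change TM2.stepAux (readAll ks r) (v.1, update v.2.1 k (S k).head?, v.2.2) _ = _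
    rw [ih]
    congr 3
    funext j
    by_cases h : j = k
    · subst h
      simp
    · simp [h]

theorem stepAux_popAll (r : Code K Γ Q) (ks : List K) (hk : ks.Nodup) (v : Store K Γ Q)
    (S : K → List Γ) (o : List Bool) :
    TM2.stepAux (popAll ks r) v (content S o) =
      TM2.stepAux r (v.1, fun k => if k ∈ ks then (S k).head? else v.2.1 k, v.2.2)
        (content (fun k => if k ∈ ks then (S k).tail else S k) o) := by
  induction ks generalizing v S with
  | nil => simp [popAll]
  | cons k ks ih =>
    rw [List.nodup_cons] at hk
    change TM2.stepAux (popAll ks r) (v.1, update v.2.1 k (S k).head?, v.2.2) (update (content S o) (some k) (S k).tail) = _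
    rw [update_content, ih hk.2]
    congr 3
    · funext j
      by_cases h : j = k
      · subst h
        simp [hk.1]
      · simp [h]
    · funext j
      by_cases h : j = k
      · subst h
        simp [hk.1]
      · simp [h]

theorem stepAux_actAll [Inhabited Γ] (r : Code K Γ Q) (ks : List K) (hk : ks.Nodup)
    (v : Store K Γ Q) (S : K → List Γ) (o : List Bool) :
    TM2.stepAux (actAll ks r) v (content S o) =
      TM2.stepAux r v (content (fun k => if k ∈ ks then (actOf v k).apply (S k) else S k) o) := by
  induction ks generalizing S with
  | nil => simp [actAll]
  | cons k ks ih =>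
    rw [List.nodup_cons] at hk
    have key : TM2.stepAux (actAll (k :: ks) r) v (content S o) = TM2.stepAux (actAll ks r) v
        (content (update S k ((actOf v k).apply (S k))) o) := by
      rw [← update_content]
      change cond (actOf v k).isSome (cond (actOf v k).join.isSome
          (TM2.stepAux (actAll ks r) v
            (update (content S o) (some k) ((actOf v k).join.getD default :: S k)))
          (TM2.stepAux (actAll ks r) v (update (content S o) (some k) (S k).tail)))
        (TM2.stepAux (actAll ks r) v (content S o)) = _
      rcases actOf v k with _ | _ | a
      · exact congrArg (TM2.stepAux (actAll ks r) v)
          (update_eq_self (some k) (content S o)).symm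
      · rfl
      · rfl
    rw [key, ih hk.2]
    congr 2
    funext j
    by_cases h : j = k
    · subst h
      simp [hk.1]
    · simp [h]

variable [Fintype K] [Inhabited Γ]

open Classical in
/-- The program of the compiled machine. The label `true` simulates one move; the label `false`
empties the stacks and then writes the verdict. -/
noncomputable def program (M : StackMachine K Γ Q) : Bool → Code K Γ Q
  | true =>
    readAll Finset.univ.toList
      (load (fun v => (v.1, v.2.1, M.next v.1 v.2.1))
        (branch (fun v => v.2.2.isLeft)
          (actAll Finset.univ.toList
            (load (fun v => (v.2.2.elim Prod.fst (fun _ => v.1), v.2)) (goto fun _ => true)))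
          (goto fun _ => false)))
  | false =>
    popAll Finset.univ.toList
      (branch (fun v => decide (∃ k, v.2.1 k ≠ none))
        (goto fun _ => false)
        (push none (fun v => (v.2.2.elim (fun _ => false) id : Bool))
          (load (fun _ => (M.start, fun _ => none, Sum.inr false)) halt)))

open Classical in
noncomputable def toFinTM2 [Fintype Γ] [Fintype Q] (M : StackMachine K Γ Q) : FinTM2 :=
  letI : Fintype (StackType K Γ (some M.input)) := inferInstanceAs (Fintype Γ)
  { K := Option K
    k₀ := some M.input
    k₁ := none
    Γ := StackType K Γ
    Λ := Bool
    main := true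
    σ := Store K Γ Q
    initialState := (M.start, fun _ => none, Sum.inr false)
    m := M.program }

theorem step_run (M : StackMachine K Γ Q) (q : Q) (x : K → Option Γ) (y) (S : K → List Γ) :
    TM2.step M.program ⟨some true, (q, x, y), content S []⟩ = some
      (match M.next q (fun k => (S k).head?) with
        | Sum.inl (q', A) => ⟨some true, (q', fun k => (S k).head?, Sum.inl (q', A)),
            content (fun k => (A k).apply (S k)) []⟩
        | Sum.inr b => ⟨some false, (q, fun k => (S k).head?, Sum.inr b), content S []⟩) := by
  simp only [TM2.step, program, stepAux_readAll, Finset.mem_toList, Finset.mem_univ, if_true,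
    TM2.stepAux]
  rcases h : M.next q (fun k => (S k).head?) with ⟨q', A⟩ | b
  · simp [stepAux_actAll _ _ (Finset.nodup_toList _), actOf]
  · simp

theorem step_clean (M : StackMachine K Γ Q) (q : Q) (x : K → Option Γ) (b : Bool)
    (S : K → List Γ) (h : ∃ k, S k ≠ []) :
    TM2.step M.program ⟨some false, (q, x, Sum.inr b), content S []⟩ =
      some ⟨some false, (q, fun k => (S k).head?, Sum.inr b), content (fun k => (S k).tail) []⟩ := by
  simp [TM2.step, program, stepAux_popAll _ _ (Finset.nodup_toList _), h]

theorem step_clean_nil (M : StackMachine K Γ Q) (q : Q) (x : K → Option Γ) (b : Bool) :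
    TM2.step M.program ⟨some false, (q, x, Sum.inr b), content (fun _ => []) []⟩ =
      some ⟨none, (M.start, fun _ => none, Sum.inr false), content (fun _ => []) [b]⟩ := by
  simp only [TM2.step, program, stepAux_popAll _ _ (Finset.nodup_toList _), Finset.mem_toList,
    Finset.mem_univ, if_true, TM2.stepAux]
  simp only [List.head?_nil, ne_eq, not_true_eq_false, exists_false, decide_false, cond_false,
    List.tail_nil, Option.some.injEq, Sum.elim_inr, id]
  congr 1
  funext k
  cases k with
  | none => rfl
  | some k => exact update_of_ne (by simp) _ _

/-- A halting configuration must have empty stacks apart from the output, and the initial store. All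
stacks are popped simultaneously, and one more step detects emptiness and writes the verdict. -/
theorem exists_clean (M : StackMachine K Γ Q) (q : Q) (b : Bool) (m : ℕ) (x : K → Option Γ)
    (S : K → List Γ) (hS : ∀ k, (S k).length ≤ m) :
    ∃ r ≤ m + 1, (flip bind (TM2.step M.program))^[r]
      (some ⟨some false, (q, x, Sum.inr b), content S []⟩) =
        some ⟨none, (M.start, fun _ => none, Sum.inr false), content (fun _ => []) [b]⟩ := by
  induction m generalizing x S with
  | zero =>
    have : S = fun _ => [] := funext fun k => List.eq_nil_of_length_eq_zero (Nat.le_zero.1 (hS k))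
    subst this
    exact ⟨1, le_rfl, step_clean_nil M q x b⟩
  | succ m ih =>
    by_cases h : ∃ k, S k ≠ []
    · obtain ⟨r, hr, e⟩ := ih (fun k => (S k).head?) (fun k => (S k).tail)
        (fun k => by have := hS k; simp; omega)
      refine ⟨r + 1, by omega, ?_⟩
      rw [Function.iterate_succ_apply]
      refine Eq.trans (congrArg _ ?_) e
      exact step_clean M q x b S h
    · push Not at h
      have : S = fun _ => [] := funext h
      subst this
      exact ⟨1, by omega, step_clean_nil M q x b⟩

/-- Each move costs one step and lengthens a stack by at most one symbol, which may cost one further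
step of cleaning; this is the factor `2`. -/
theorem RunsTo.exists_steps {M : StackMachine K Γ Q} {t : ℕ} {q : Q} {S : K → List Γ} {b : Bool}
    (h : M.RunsTo t q S b) (m : ℕ) (x : K → Option Γ) (y) (hS : ∀ k, (S k).length ≤ m) :
    ∃ r ≤ m + 2 * t + 2, (flip bind (TM2.step M.program))^[r]
      (some ⟨some true, (q, x, y), content S []⟩) =
        some ⟨none, (M.start, fun _ => none, Sum.inr false), content (fun _ => []) [b]⟩ := by
  induction h generalizing m x y with
  | @halt t q S b h =>
    obtain ⟨r, hr, e⟩ := exists_clean M q b m (fun k => (S k).head?) S hS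
    refine ⟨r + 1, by omega, ?_⟩
    rw [Function.iterate_succ_apply]
    refine Eq.trans (congrArg _ ?_) e
    refine (step_run M q x y S).trans ?_
    rw [h]
  | @step t q q' S A b h _ ih =>
    obtain ⟨r, hr, e⟩ := ih (m + 1) (fun k => (S k).head?) (Sum.inl (q', A))
      (fun k => (StackAct.length_apply_le _ _).trans (Nat.succ_le_succ (hS k)))
    refine ⟨r + 1, by omega, ?_⟩
    rw [Function.iterate_succ_apply]
    refine Eq.trans (congrArg _ ?_) e
    refine (step_run M q x y S).trans ?_
    rw [h]

end Compile

/-- A language decided by a stack machine in polynomial time is in `P`. -/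
theorem mem_classP [DecidableEq K] [Fintype K] [Fintype Γ] [Fintype Q] [Inhabited Γ]
    (M : StackMachine K Γ Q) (L : Language Γ) (f : List Γ → Bool) (hf : ∀ s, f s = true ↔ s ∈ L)
    (p : Polynomial ℕ)
    (h : ∀ s, M.RunsTo (p.eval s.length) M.start (fun k => if k = M.input then s else []) (f s)) :
    L ∈ ClassP Γ := by
  classical
  refine ⟨f, hf, ⟨?_⟩⟩
  have key : ∀ s : List Γ, ∃ r ≤ (Polynomial.X + 2 * p + 2).eval s.length,
      (flip bind M.toFinTM2.step)^[r] (some (Turing.initList M.toFinTM2 s)) =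
        some (Turing.haltList M.toFinTM2 [f s]) := by
    intro s
    obtain ⟨r, hr, e⟩ := (h s).exists_steps s.length (fun _ => none) (Sum.inr false)
      (fun k => by split_ifs <;> simp)
    refine ⟨r, by simpa using hr, ?_⟩
    have h1 : Turing.initList M.toFinTM2 s = ⟨some true, (M.start, fun _ => none, Sum.inr false),
        content (fun k => if k = M.input then s else []) []⟩ := by
      unfold Turing.initList
      congr 1
      funext k
      cases k with
      | none => exact dif_neg (by simp [toFinTM2])
      | some k =>
        by_cases hk : k = M.input
        · subst hk
          simp only [content, if_true]
          exact dif_pos rfl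
        · simp only [content, if_neg hk]
          exact dif_neg (by simpa [toFinTM2] using hk)
    have h2 : Turing.haltList M.toFinTM2 [f s] =
        ⟨none, (M.start, fun _ => none, Sum.inr false), content (fun _ => []) [f s]⟩ := by
      unfold Turing.haltList
      congr 1
      funext k
      cases k with
      | none => exact dif_pos rfl
      | some k => exact dif_neg (by simp [toFinTM2])
    rw [h1, h2]
    exact e
  refine
    { tm := M.toFinTM2
      inputAlphabet := Equiv.refl Γ
      outputAlphabet := Equiv.refl Bool
      time := Polynomial.X + 2 * p + 2
      outputsFun := fun s => ?_ }
  refine ⟨⟨(key s).choose, ?_⟩, (key s).choose_spec.1⟩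
  refine Eq.trans ?_ ((key s).choose_spec.2.trans ?_)
  · congr 3
    exact List.map_id _
  · rfl

end StackMachine

end MeetStalactic

/-! ### Identities in terms of substituted words -/

namespace MeetStalactic

section Substitution

variable {α : Type} [DecidableEq α]

/-- The case `a = b` is allowed and tests whether `a` occurs. -/
def pickFirst (a b : α) (w : List α) : Option α := w.find? (fun c => c = a ∨ c = b)

theorem pickFirst_initialPart (a b : α) (w : List α) :
    pickFirst a b (initialPart w) = pickFirst a b w := by
  induction w using List.reverseRecOn with
  | nil => rfl
  | append_singleton w c ih =>
    unfold pickFirst at ih ⊢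
    rw [initialPart_concat]
    split_ifs with h
    · rw [ih, List.find?_append]
      by_cases hc : c = a ∨ c = b
      · have : (w.find? (fun c => decide (c = a ∨ c = b))).isSome := by
          rw [List.find?_isSome]
          exact ⟨c, (mem_initialPart w c).1 h, by simpa using hc⟩
        rw [Option.or_of_isSome this]
      · rw [List.find?_singleton, if_neg (by simpa using hc), Option.or_none]
    · rw [List.find?_append, List.find?_append, ih]

theorem nodup_initialPart (w : List α) : (initialPart w).Nodup := by
  induction w using List.reverseRecOn with
  | nil => exact List.nodup_nil
  | append_singleton w c ih =>
    rw [initialPart_concat]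
    split_ifs with h
    · exact ih
    · exact List.nodup_append.2 ⟨ih, List.nodup_singleton c, fun x hx y hy => by
        rw [List.mem_singleton] at hy
        rintro rfl
        exact h (hy ▸ hx)⟩

/-- The heads agree by the question about the two heads. The tails inherit the hypothesis: the
common head `c` is absent from both, so a question about `c` and `b` reduces to one about `b` alone.
-/
theorem eq_of_pickFirst_eq {l m : List α} (hl : l.Nodup) (hm : m.Nodup)
    (h : ∀ a b, pickFirst a b l = pickFirst a b m) : l = m := by
  induction l generalizing m with
  | nil =>
    cases m with
    | nil => rfl
    | cons d m => simpa [pickFirst] using h d d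
  | cons c l ih =>
    cases m with
    | nil => simpa [pickFirst] using h c c
    | cons d m =>
      have hcd : c = d := by simpa [pickFirst] using h c d
      subst hcd
      rw [List.nodup_cons] at hl hm
      have aux : ∀ b (l : List α), c ∉ l → pickFirst c b l = pickFirst b b l := by
        intro b l hc
        refine List.find?_congr fun x hx => ?_
        have : x ≠ c := fun e => hc (e ▸ hx)
        simp [this]
      have symm : ∀ a b (l : List α), pickFirst a b l = pickFirst b a l := by
        intro a b l
        simp only [pickFirst, or_comm]
      have aux' : ∀ a b, a ≠ c → b ≠ c → pickFirst a b l = pickFirst a b m := by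
        intro a b ha hb
        have := h a b
        simpa [pickFirst, ha.symm, hb.symm] using this
      have aux'' : ∀ b, pickFirst c b l = pickFirst c b m := by
        intro b
        by_cases hb : b = c
        · subst hb
          have : ∀ l : List α, b ∉ l → pickFirst b b l = none := by
            intro l hb
            refine List.find?_eq_none.2 fun x hx => ?_
            have : x ≠ b := fun e => hb (e ▸ hx)
            simp [this]
          rw [this l hl.1, this m hm.1]
        · rw [aux b l hl.1, aux b m hm.1, aux' b b hb hb]
      rw [ih hl.2 hm.2]
      intro a b
      by_cases ha : a = c
      · subst ha
        exact aux'' b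
      by_cases hb : b = c
      · subst hb
        rw [symm, aux'' a, symm]
      exact aux' a b ha hb

theorem leftTableau_eq_iff_pickFirst (u v : List α) : leftTableau u = leftTableau v ↔
    (∀ a b, pickFirst a b u = pickFirst a b v) ∧ ∀ a, u.count a = v.count a := by
  rw [leftTableau_eq_iff]
  refine and_congr_left fun _ => ⟨fun h a b => ?_, fun h => ?_⟩
  · rw [← pickFirst_initialPart, h, pickFirst_initialPart]
  · refine eq_of_pickFirst_eq (nodup_initialPart u) (nodup_initialPart v) fun a b => ?_
    rw [pickFirst_initialPart, h, pickFirst_initialPart]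

def Variable.index : Variable → ℕ := Sum.elim id id

def Variable.starred : Variable → Bool := Sum.isRight

/-- The word which is substituted for a variable, given the word `w` which is substituted for its
unstarred version. -/
def tokenWord (σ : α → α) (w : List α) : Bool → List α
  | false => w
  | true => (w.map σ).reverse

def substWord (σ : α → α) (φ : ℕ → List α) (u : List Variable) : List α :=
  u.flatMap (fun t => tokenWord σ (φ t.index) t.starred)

omit [DecidableEq α] in
theorem reverse_tokenWord (σ : α → α) (w : List α) (s : Bool) :
    (tokenWord σ w s).reverse = tokenWord σ w.reverse s := by
  cases s <;> simp [tokenWord]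

omit [DecidableEq α] in
theorem reverse_substWord (σ : α → α) (φ : ℕ → List α) (u : List Variable) :
    (substWord σ φ u).reverse = substWord σ (fun k => (φ k).reverse) u.reverse := by
  unfold substWord
  rw [List.reverse_flatMap]
  congr 1
  funext t
  exact reverse_tokenWord σ _ _

theorem pickFirst_substWord (σ : α → α) (φ : ℕ → List α) (u : List Variable) (a b : α) :
    pickFirst a b (substWord σ φ u) =
      u.findSome? (fun t => pickFirst a b (tokenWord σ (φ t.index) t.starred)) := by
  rw [pickFirst, substWord, List.find?_flatMap]
  rfl

theorem count_substWord (σ : α → α) (φ : ℕ → List α) (u : List Variable) (a : α) :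
    (substWord σ φ u).count a =
      (u.map (fun t => (tokenWord σ (φ t.index) t.starred).count a)).sum := by
  rw [substWord, List.count_flatMap]
  rfl

theorem evalWord_involution {n : ℕ} (σ : Equiv.Perm (Fin n)) (hσ : σ * σ = 1)
    (φ : ℕ → List (Fin n)) (u : List Variable) :
    evalWord (involution σ hσ) (fun k => ((FreeMonoid.ofList (φ k) : FreeMonoid (Fin n)) : MSt n)) u
      = ((FreeMonoid.ofList (substWord σ φ u) : FreeMonoid (Fin n)) : MSt n) := by
  induction u with
  | nil => rfl
  | cons t u ih =>
    have h1 : substWord σ φ (t :: u) = tokenWord σ (φ t.index) t.starred ++ substWord σ φ u := by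
      simp [substWord]
    unfold evalWord at ih ⊢
    rw [List.map_cons, List.prod_cons, ih, h1, FreeMonoid.ofList_append, Con.coe_mul]
    cases t <;> rfl

theorem satisfies_iff_substWord {n : ℕ} (σ : Equiv.Perm (Fin n)) (hσ : σ * σ = 1)
    (u v : List Variable) : Satisfies (involution σ hσ) u v ↔ ∀ φ : ℕ → List (Fin n),
      leftTableau (substWord σ φ u) = leftTableau (substWord σ φ v) ∧
        leftTableau (substWord σ φ u).reverse = leftTableau (substWord σ φ v).reverse := by
  have key : ∀ φ : ℕ → List (Fin n),
      (((FreeMonoid.ofList (substWord σ φ u) : FreeMonoid (Fin n)) : MSt n) =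
        ((FreeMonoid.ofList (substWord σ φ v) : FreeMonoid (Fin n)) : MSt n)) ↔
      (leftTableau (substWord σ φ u) = leftTableau (substWord σ φ v) ∧
        leftTableau (substWord σ φ u).reverse = leftTableau (substWord σ φ v).reverse) := by
    intro φ
    rw [Con.eq]
    change (leftTableau _ = leftTableau _ ∧ rightTableau _ = rightTableau _) ↔ _
    simp only [rightTableau_eq, List.reverse_inj, FreeMonoid.toList_ofList]
  constructor
  · intro h φ
    rw [← key, ← evalWord_involution σ hσ, ← evalWord_involution σ hσ]
    exact h _
  · intro h φ
    have : ∃ ψ : ℕ → List (Fin n),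
        φ = fun k => ((FreeMonoid.ofList (ψ k) : FreeMonoid (Fin n)) : MSt n) := by
      choose ψ hψ using fun k => Con.mk'_surjective (c := meetCon (Fin n)) (φ k)
      exact ⟨fun k => (ψ k).toList, funext fun k => (hψ k).symm⟩
    obtain ⟨ψ, rfl⟩ := this
    rw [evalWord_involution, evalWord_involution, key]
    exact h ψ

/-! ### Reduction to pairs of variables -/

/-- The label of a variable with respect to two names: which of the names it has, if any, and
whether it is starred. -/
def label (N : Bool → List Bool) (t : Variable) : Option (Bool × Bool) :=
  if t.index.bits = N false then some (false, t.starred)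
  else if t.index.bits = N true then some (true, t.starred) else none

def firstVal (N : Bool → List Bool) (g : Bool × Bool → Option α) (u : List Variable) : Option α :=
  u.findSome? (fun t => (label N t).bind g)

/-- The number of variables in `u` which are named by `N` and belong to the class `c`. -/
def nameCount (cls : Bool → Option Bool) (N : List Bool) (c : Bool) (u : List Variable) : ℕ :=
  u.countP (fun t => t.index.bits = N ∧ cls t.starred = some c)

/-- The condition tested by one pass over the identity. Counting for the first name is enough, as
every variable takes that place in some pair. -/
def PairOk (cls : Bool → Option Bool) (G : Set (Bool × Bool → Option α)) (N : Bool → List Bool)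
    (u v : List Variable) : Prop :=
  (∀ c, nameCount cls (N false) c u = nameCount cls (N false) c v) ∧
    ∀ g ∈ G, firstVal N g u = firstVal N g v ∧ firstVal N g u.reverse = firstVal N g v.reverse

/-- The first occurrences of `a` or `b` in the words substituted for two variables and their
starred versions. -/
def patterns (σ : α → α) : Set (Bool × Bool → Option α) :=
  {g | ∃ (w : Bool → List α) (a b : α), g = fun p => pickFirst a b (tokenWord σ (w p.1) p.2)}

open Classical in
/-- Occurrences of `x` and `x*` need not be counted if the alphabet is empty, they are counted
together if the involution fixes all letters, and they are counted separately otherwise. -/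
noncomputable def countClass (σ : α → α) (s : Bool) : Option Bool :=
  if IsEmpty α then none else if ∀ a, σ a = a then some false else some s

theorem bits_injective : Function.Injective Nat.bits := fun m n h =>
  Nat.eq_of_testBit_eq fun i => by rw [Nat.testBit_eq_inth, Nat.testBit_eq_inth, h]

/-- Substituting a single letter isolates the class `c`. If `σ` moves `a`, then `x ↦ a` gives `x* ↦
σ a ≠ a`, and counting `a` or `σ a` separates the two. -/
theorem exists_count_eq_ite (σ : α → α) (c : Bool) : (∀ s, countClass σ s ≠ some c) ∨
    ∃ a b, ∀ s, (tokenWord σ [a] s).count b = if countClass σ s = some c then 1 else 0 := by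
  classical
  by_cases h : IsEmpty α
  · exact Or.inl fun s => by simp [countClass, h]
  by_cases h' : ∀ a, σ a = a
  · cases c with
    | true => exact Or.inl fun s => by simp [countClass, h, h']
    | false =>
      obtain ⟨a⟩ := not_isEmpty_iff.1 h
      exact Or.inr ⟨a, a, fun s => by cases s <;> simp [countClass, h, h', tokenWord]⟩
  · push Not at h'
    obtain ⟨a, ha⟩ := h'
    have hs : ∀ s, countClass σ s = some s := fun s => by
      rw [countClass, if_neg h, if_neg fun e => ha (e a)]
    refine Or.inr ⟨a, if c then σ a else a, fun s => ?_⟩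
    rw [hs]
    cases s <;> cases c <;> simp [tokenWord, ha, ha.symm]

theorem count_tokenWord_of_countClass_eq (σ : α → α) {s s' : Bool}
    (h : countClass σ s = countClass σ s') (w : List α) (a : α) :
    (tokenWord σ w s).count a = (tokenWord σ w s').count a := by
  have ha : ¬ IsEmpty α := fun e => e.elim a
  unfold countClass at h
  rw [if_neg ha, if_neg ha] at h
  split_ifs at h with hσ
  · have : w.map σ = w := by
      rw [List.map_congr_left fun x _ => hσ x, List.map_id']
    cases s <;> cases s' <;> simp [tokenWord, this]
  · rw [Option.some.inj h]

theorem nameCount_eq_of_count {σ : α → α} {u v : List Variable}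
    (h : ∀ φ a, (substWord σ φ u).count a = (substWord σ φ v).count a) (N : List Bool)
    (c : Bool) : nameCount (countClass σ) N c u = nameCount (countClass σ) N c v := by
  rcases exists_count_eq_ite σ c with hc | ⟨a, b, hab⟩
  · have : ∀ w, nameCount (countClass σ) N c w = 0 := fun w => by simp [nameCount, hc]
    rw [this, this]
  · have key : ∀ w, nameCount (countClass σ) N c w =
        (substWord σ (fun k => if k.bits = N then [a] else []) w).count b := by
      intro w
      rw [count_substWord]
      induction w with
      | nil => rfl
      | cons t w ih =>
        rw [List.map_cons, List.sum_cons, ← ih, nameCount, nameCount, List.countP_cons, add_comm]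
        congr 1
        by_cases ht : t.index.bits = N
        · simp [ht, hab]
        · cases hs : t.starred <;> simp [ht, tokenWord]
    rw [key, key, h]

/-- The contribution of a variable to the count depends only on its index and class, and the two
sides have the same multiset of such pairs. -/
theorem count_eq_of_nameCount {σ : α → α} {u v : List Variable}
    (h : ∀ k c, nameCount (countClass σ) (Nat.bits k) c u =
      nameCount (countClass σ) (Nat.bits k) c v) (φ : ℕ → List α) (a : α) :
    (substWord σ φ u).count a = (substWord σ φ v).count a := by
  have ha : ¬ IsEmpty α := fun e => e.elim a
  let key : Variable → ℕ × Option Bool := fun t => (t.index, countClass σ t.starred)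
  have hsome : ∀ s, countClass σ s ≠ none := fun s => by
    unfold countClass
    split_ifs <;> simp
  have hperm : (u.map key).Perm (v.map key) := by
    rw [List.perm_iff_count]
    rintro ⟨k, o⟩
    rw [List.count_eq_countP, List.countP_map, List.count_eq_countP, List.countP_map]
    cases o with
    | none => simp [key, hsome, Function.comp_def, beq_eq_decide]
    | some c =>
      have := h k c
      simp only [nameCount, bits_injective.eq_iff] at this
      simpa [key, Function.comp_def, beq_eq_decide, Bool.decide_and] using this
  -- The contribution factors through `key` because variables with equal keys contribute equally.
  have hfac : ∃ F : ℕ × Option Bool → ℕ,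
      (fun t => (tokenWord σ (φ t.index) t.starred).count a) = F ∘ key := by
    refine ⟨Function.extend key (fun t => (tokenWord σ (φ t.index) t.starred).count a) 0, ?_⟩
    refine (Function.FactorsThrough.extend_comp _ ?_).symm
    intro t t' e
    obtain ⟨e1, e2⟩ := Prod.ext_iff.1 e
    dsimp only [key] at e1 e2
    dsimp only
    rw [e1]
    exact count_tokenWord_of_countClass_eq σ e2 _ _
  obtain ⟨F, hF⟩ := hfac
  rw [count_substWord, count_substWord, hF, ← List.map_map, ← List.map_map]
  exact (hperm.map F).sum_eq

omit [DecidableEq α] in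
-- Take for `p` the first entry with a value. If there is none, any entry will do, since `f'` then
-- has no values either.
theorem exists_findSome?_eq {β : Type} (f : β → Option α) {u : List β} (hu : u ≠ []) :
    ∃ p ∈ u, ∀ f' : β → Option α, (∀ t, f' t = f t ∨ f' t = none) → f' p = f p →
      u.findSome? f' = u.findSome? f := by
  induction u with
  | nil => exact absurd rfl hu
  | cons t u ih =>
    by_cases ht : f t = none
    · by_cases hu' : u = []
      · subst hu'
        exact ⟨t, List.mem_cons_self, fun f' _ h => by simp [List.findSome?_cons, h]⟩
      · obtain ⟨p, hp, h⟩ := ih hu'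
        refine ⟨p, List.mem_cons_of_mem t hp, fun f' hf' hfp => ?_⟩
        have : f' t = none := (hf' t).elim (fun e => e.trans ht) id
        rw [List.findSome?_cons, List.findSome?_cons, this, ht]
        exact h f' hf' hfp
    · obtain ⟨a, ha⟩ := Option.ne_none_iff_exists'.1 ht
      refine ⟨t, List.mem_cons_self, fun f' _ h => ?_⟩
      rw [List.findSome?_cons, List.findSome?_cons, h, ha]

/-- Let `s` and `t` be the variables responsible for the answers in `u` and `v`. Keeping only the
variables with the index of `s` or `t` preserves both answers. -/
theorem pickFirst_substWord_eq {σ : α → α} {u v : List Variable} (hu : u ≠ []) (hv : v ≠ [])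
    (h : ∀ s ∈ u, ∀ t ∈ v, ∀ g ∈ patterns σ,
      firstVal (fun i => Nat.bits (bif i then t.index else s.index)) g u =
        firstVal (fun i => Nat.bits (bif i then t.index else s.index)) g v)
    (φ : ℕ → List α) (a b : α) :
    pickFirst a b (substWord σ φ u) = pickFirst a b (substWord σ φ v) := by
  rw [pickFirst_substWord, pickFirst_substWord]
  set f : Variable → Option α := fun t => pickFirst a b (tokenWord σ (φ t.index) t.starred) with hf
  obtain ⟨s, hs, hsu⟩ := exists_findSome?_eq f hu
  obtain ⟨t, ht, htv⟩ := exists_findSome?_eq f hv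
  have key := h s hs t ht
    (fun p => pickFirst a b (tokenWord σ (φ (bif p.1 then t.index else s.index)) p.2))
    ⟨fun i => φ (bif i then t.index else s.index), a, b, rfl⟩
  unfold firstVal at key
  rw [hsu, htv] at key
  · exact key
  all_goals simp only [label, bits_injective.eq_iff, cond_true, cond_false]
  · intro r
    split_ifs <;> simp [*]
  · split_ifs with h1 <;> simp [hf, h1]
  · intro r
    split_ifs <;> simp [*]
  · simp [hf]

/-- Substitute the empty word for every variable that has neither name. -/
theorem firstVal_eq_of_pickFirst {σ : α → α} {u v : List Variable}
    (h : ∀ φ a b, pickFirst a b (substWord σ φ u) = pickFirst a b (substWord σ φ v))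
    (N : Bool → List Bool) {g : Bool × Bool → Option α} (hg : g ∈ patterns σ) :
    firstVal N g u = firstVal N g v := by
  obtain ⟨w, a, b, rfl⟩ := hg
  have := h (fun k => if k.bits = N false then w false else if k.bits = N true then w true else [])
    a b
  rw [pickFirst_substWord, pickFirst_substWord] at this
  have hlabel : ∀ t : Variable, (label N t).bind
      (fun p => pickFirst a b (tokenWord σ (w p.1) p.2)) = pickFirst a b (tokenWord σ
        (if t.index.bits = N false then w false else if t.index.bits = N true then w true else [])
        t.starred) := by
    intro t
    unfold label
    split_ifs
    · rfl
    · rfl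
    · cases t.starred <;> rfl
  simpa only [firstVal, hlabel] using this

end Substitution

variable {n : ℕ} (σ : Equiv.Perm (Fin n)) (hσ : σ * σ = 1)

theorem pairOk_of_satisfies {u v : List Variable} (h : Satisfies (involution σ hσ) u v)
    (N : Bool → List Bool) : PairOk (countClass σ) (patterns σ) N u v := by
  rw [satisfies_iff_substWord] at h
  simp only [leftTableau_eq_iff_pickFirst] at h
  refine ⟨fun c => nameCount_eq_of_count (fun φ => (h φ).1.2) _ c, fun g hg => ⟨?_, ?_⟩⟩
  · exact firstVal_eq_of_pickFirst (fun φ => (h φ).1.1) N hg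
  · refine firstVal_eq_of_pickFirst (fun φ a b => ?_) N hg
    -- Reversing a value reverses both the word and the substituted words, so the reversed
    -- substitution is used here.
    have := (h fun k => (φ k).reverse).2.1 a b
    simpa only [reverse_substWord, List.reverse_reverse] using this

theorem satisfies_of_pairOk {u v : List Variable} (hu : u ≠ []) (hv : v ≠ [])
    (h : ∀ s ∈ u ++ v, ∀ t ∈ u ++ v, PairOk (countClass σ) (patterns σ)
      (fun i => Nat.bits (bif i then t.index else s.index)) u v) :
    Satisfies (involution σ hσ) u v := by
  rw [satisfies_iff_substWord]
  simp only [leftTableau_eq_iff_pickFirst]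
  have hc : ∀ φ a, (substWord σ φ u).count a = (substWord σ φ v).count a := by
    refine count_eq_of_nameCount fun k c => ?_
    by_cases hk : ∃ s ∈ u ++ v, s.index = k
    · obtain ⟨s, hs, rfl⟩ := hk
      exact (h s hs s hs).1 c
    · push Not at hk
      have : ∀ w ⊆ u ++ v, nameCount (countClass σ) k.bits c w = 0 := fun w hw => by
        simp only [nameCount, bits_injective.eq_iff]
        exact List.countP_eq_zero.2 fun s hs => by simp [hk s (hw hs)]
      rw [this u (List.subset_append_left u v), this v (List.subset_append_right u v)]
  intro φ
  refine ⟨⟨?_, hc φ⟩, ?_, fun a => by simpa using hc φ a⟩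
  · exact pickFirst_substWord_eq hu hv (fun s hs t ht g hg =>
      ((h s (List.mem_append_left v hs) t (List.mem_append_right u ht)).2 g hg).1) φ
  · intro a b
    rw [reverse_substWord, reverse_substWord]
    refine pickFirst_substWord_eq (by simpa using hu) (by simpa using hv)
      (fun s hs t ht g hg => ?_) _ a b
    exact ((h s (List.mem_append_left v (List.mem_reverse.1 hs)) t
      (List.mem_append_right u (List.mem_reverse.1 ht))).2 g hg).2

end MeetStalactic

/-! ### Recognizing encoded identities -/

namespace MeetStalactic

noncomputable instance : DecidableEq Sym := Classical.decEq _

instance : Inhabited Sym := ⟨Sym.plain⟩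

noncomputable instance : Fintype Sym where
  elems := {Sym.bit false, Sym.bit true, Sym.plain, Sym.star, Sym.approx}
  complete := by rintro ((_ | _) | _ | _ | _) <;> simp

section Parsing

/-- The states of the automaton that recognizes encoded identities. A state other than `none`, which
means failure, tells whether `≈` has been read, whether the current side of the identity contains a
variable, and the last digit that has been read of the current numeral. -/
abbrev ParseState : Type := Option (Bool × Bool × Option Bool)

def mark (s : Bool) : Sym := bif s then Sym.star else Sym.plain

def parseMark : Bool × Bool × Option Bool → ParseState
  | (_, _, some false) => none
  | (p, _, _) => some (p, true, none)

def parseStep : ParseState → Sym → ParseState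
  | none, _ => none
  | some (p, e, _), Sym.bit b => some (p, e, some b)
  | some x, Sym.plain => parseMark x
  | some x, Sym.star => parseMark x
  | some (false, true, none), Sym.approx => some (true, false, none)
  | some _, Sym.approx => none

abbrev encodeWord (u : List Variable) : List Sym := u.flatMap encodeVariable

theorem encodeVariable_eq (t : Variable) :
    encodeVariable t = t.index.bits.map Sym.bit ++ [mark t.starred] := by
  cases t <;> rfl

theorem parseStep_mark (x : Bool × Bool × Option Bool) (s : Bool) :
    parseStep (some x) (mark s) = parseMark x := by
  obtain ⟨p, e, o⟩ := x
  cases s <;> rfl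

theorem getLast?_bits_ne (k : ℕ) : k.bits.getLast? ≠ some false := by
  induction k using Nat.binaryRec' with
  | zero => simp
  | bit b n h ih =>
    rw [Nat.bits_append_bit n b h]
    cases hn : n.bits with
    | nil =>
      have : n = 0 := bits_injective (by rw [hn, Nat.zero_bits])
      simp [h this]
    | cons c l => rwa [List.getLast?_cons_cons, ← hn]

/-- Together with `getLast?_bits_ne` this characterizes canonical numerals: the most significant
digit, which comes last, is not `0`. Hence the last digit is all that the parser has to remember. -/
theorem exists_bits_eq (l : List Bool) (h : l.getLast? ≠ some false) : ∃ k : ℕ, k.bits = l := by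
  induction l with
  | nil => exact ⟨0, Nat.zero_bits⟩
  | cons b l ih =>
    obtain ⟨k, hk⟩ := ih fun e => h (by
      cases l with
      | nil => simp at e
      | cons c l => rwa [List.getLast?_cons_cons])
    refine ⟨Nat.bit b k, ?_⟩
    rw [Nat.bits_append_bit, hk]
    rintro rfl
    rw [Nat.zero_bits] at hk
    subst hk
    simpa using h

theorem foldl_parseStep_bits (l : List Bool) (p e : Bool) (o : Option Bool) :
    (l.map Sym.bit).foldl parseStep (some (p, e, o)) = some (p, e, l.getLast?.or o) := by
  induction l using List.reverseRecOn with
  | nil => simp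
  | append_singleton l b ih => simp [ih, parseStep]

theorem foldl_parseStep_encodeWord (u : List Variable) (p e : Bool) :
    (encodeWord u).foldl parseStep (some (p, e, none)) = some (p, e || !u.isEmpty, none) := by
  induction u generalizing e with
  | nil => simp
  | cons t u ih =>
    rw [encodeWord, List.flatMap_cons, List.foldl_append, encodeVariable_eq, List.foldl_append,
      foldl_parseStep_bits, Option.or_none]
    have : parseMark (p, e, t.index.bits.getLast?) = some (p, true, none) := by
      rcases h : t.index.bits.getLast? with _ | _ | _
      · rfl
      · exact absurd h (getLast?_bits_ne _)
      · rfl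
    rw [List.foldl_cons, List.foldl_nil, parseStep_mark, this, ih]
    simp

/-- The invariant of the parser: the input read so far consists of complete variables, possibly `≈`,
and the digits `bs` of an unfinished numeral. -/
def Parsed (s : List Sym) : ParseState → Prop
  | none => True
  | some (false, e, o) => ∃ (u : List Variable) (bs : List Bool), s = encodeWord u ++ bs.map Sym.bit ∧
      (e = true → u ≠ []) ∧ bs.getLast? = o
  | some (true, e, o) => ∃ (u v : List Variable) (bs : List Bool), u ≠ [] ∧
      s = encodeWord u ++ [Sym.approx] ++ encodeWord v ++ bs.map Sym.bit ∧
      (e = true → v ≠ []) ∧ bs.getLast? = o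

theorem exists_encodeWord_append_mark (u : List Variable) (bs : List Bool) (s : Bool)
    (h : bs.getLast? ≠ some false) :
    ∃ u', u' ≠ [] ∧ encodeWord u ++ bs.map Sym.bit ++ [mark s] = encodeWord u' := by
  obtain ⟨k, rfl⟩ := exists_bits_eq bs h
  refine ⟨u ++ [bif s then Sum.inr k else Sum.inl k], by simp, ?_⟩
  cases s <;> simp [encodeWord, encodeVariable, mark]

theorem Parsed.mark {s : List Sym} {x : Bool × Bool × Option Bool} (h : Parsed s (some x))
    (b : Bool) : Parsed (s ++ [mark b]) (parseMark x) := by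
  obtain ⟨p, e, o⟩ := x
  by_cases ho : o = some false
  · subst ho
    trivial
  have hm : parseMark (p, e, o) = some (p, true, none) := by
    rcases o with _ | _ | _ <;> first | rfl | exact absurd rfl ho
  rw [hm]
  cases p with
  | false =>
    obtain ⟨u, bs, rfl, -, rfl⟩ := h
    obtain ⟨u', hu', e'⟩ := exists_encodeWord_append_mark u bs b ho
    exact ⟨u', [], by simp [e'], fun _ => hu', rfl⟩
  | true =>
    obtain ⟨u, v, bs, hu, rfl, -, rfl⟩ := h
    obtain ⟨v', hv', e'⟩ := exists_encodeWord_append_mark v bs b ho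
    refine ⟨u, v', [], hu, ?_, fun _ => hv', rfl⟩
    rw [← e']
    simp

theorem parsed_foldl (s : List Sym) : Parsed s (s.foldl parseStep (some (false, false, none))) := by
  induction s using List.reverseRecOn with
  | nil => exact ⟨[], [], by simp⟩
  | append_singleton s a ih =>
    rw [List.foldl_append, List.foldl_cons, List.foldl_nil]
    rcases hx : s.foldl parseStep (some (false, false, none)) with _ | ⟨p, e, o⟩
    · trivial
    rw [hx] at ih
    cases a with
    | plain => exact ih.mark false
    | star => exact ih.mark true
    | bit b =>
      cases p with
      | false =>
        obtain ⟨u, bs, rfl, he, -⟩ := ih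
        exact ⟨u, bs ++ [b], by simp, he, by simp⟩
      | true =>
        obtain ⟨u, v, bs, hu, rfl, he, -⟩ := ih
        exact ⟨u, v, bs ++ [b], hu, by simp, he, by simp⟩
    | approx =>
      rcases p with _ | _
      · rcases e with _ | _
        · trivial
        · rcases o with _ | _
          · obtain ⟨u, bs, rfl, he, hb⟩ := ih
            rw [List.getLast?_eq_none_iff] at hb
            subst hb
            exact ⟨u, [], [], he rfl, by simp, by simp, rfl⟩
          · trivial
      · rcases e with _ | _ <;> rcases o with _ | _ <;> trivial

theorem foldl_parseStep_eq_iff (s : List Sym) :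
    s.foldl parseStep (some (false, false, none)) = some (true, true, none) ↔
      ∃ u v : List Variable, u ≠ [] ∧ v ≠ [] ∧ s = encodeIdentity u v := by
  constructor
  · intro h
    have := parsed_foldl s
    rw [h] at this
    obtain ⟨u, v, bs, hu, rfl, hv, hb⟩ := this
    rw [List.getLast?_eq_none_iff] at hb
    subst hb
    exact ⟨u, v, hu, hv rfl, by simp [encodeIdentity]⟩
  · rintro ⟨u, v, hu, hv, rfl⟩
    rw [encodeIdentity, List.foldl_append, List.foldl_append, foldl_parseStep_encodeWord]
    have h1 : (!u.isEmpty) = true := by simpa using hu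
    have h2 : (!v.isEmpty) = true := by simpa using hv
    rw [h1, Bool.false_or, List.foldl_cons, List.foldl_nil]
    change (encodeWord v).foldl parseStep (some (true, false, none)) = _
    rw [foldl_parseStep_encodeWord, h2]
    rfl

/-- The name at the top of a stack: its maximal initial segment that consists of digits. -/
def nameOf : List Sym → List Bool
  | Sym.bit b :: s => b :: nameOf s
  | _ => []

def isDigit : Option Sym → Bool
  | some (Sym.bit _) => true
  | _ => false

/-- The right-hand side is what a scan can observe: digits agree one by one, and no digit is left on
the stack afterwards. -/
theorem nameOf_eq_iff (l : List Bool) (s : List Sym) :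
    nameOf s = l ↔ l.map Sym.bit <+: s ∧ isDigit (s.drop l.length).head? = false := by
  induction l generalizing s with
  | nil => rcases s with _ | ⟨_ | _ | _ | _, s⟩ <;> simp [nameOf, isDigit]
  | cons b l ih =>
    rcases s with _ | ⟨c | _ | _ | _, s⟩
    · simp [nameOf]
    · simp [nameOf, ih, List.cons_prefix_cons, and_assoc, eq_comm (a := c)]
    all_goals simp [nameOf, List.cons_prefix_cons]

theorem nameOf_encodeVariable_append (t : Variable) (s : List Sym) :
    nameOf (encodeVariable t ++ s) = t.index.bits := by
  rw [nameOf_eq_iff, encodeVariable_eq, List.append_assoc]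
  refine ⟨List.prefix_append _ _, ?_⟩
  cases h : t.starred <;> simp [isDigit, mark]

theorem exists_suffix_of_mem {t : Variable} {u v : List Variable} (h : t ∈ u ++ v) :
    ∃ s, s <:+ encodeIdentity u v ∧ nameOf s = t.index.bits := by
  have key : ∀ w : List Variable, t ∈ w → ∃ r, (encodeVariable t ++ r) <:+ encodeWord w := by
    intro w hw
    obtain ⟨w₁, w₂, rfl⟩ := List.append_of_mem hw
    exact ⟨encodeWord w₂, encodeWord w₁, by simp [encodeWord]⟩
  rcases List.mem_append.1 h with h | h
  · obtain ⟨r, r', hr⟩ := key u h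
    refine ⟨encodeVariable t ++ r ++ ([Sym.approx] ++ encodeWord v), ⟨r', ?_⟩, ?_⟩
    · rw [encodeIdentity, List.append_assoc _ [Sym.approx], ← encodeWord, ← hr]
      simp
    · rw [List.append_assoc, nameOf_encodeVariable_append]
  · obtain ⟨r, hr⟩ := key v h
    exact ⟨encodeVariable t ++ r, hr.trans (List.suffix_append _ _),
      nameOf_encodeVariable_append t r⟩

end Parsing

end MeetStalactic

/-! ### The checking machine and the scan of one variable -/

namespace MeetStalactic

inductive Stack
  | src
  | dst
  | name (i : Bool)
  | done (i : Bool)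
  | cnt (c : Bool)
  deriving DecidableEq, Fintype

/-- For both sides of an identity (`false` for the left one), the first values and the first values
of the reverse of the part that has been read, under all assignments of values to labels. -/
abbrev Acc (α : Type) : Type :=
  Bool → ((Bool × Bool → Option α) → Option α) × ((Bool × Bool → Option α) → Option α)

/-- An earlier value takes precedence in the first component, and the newest one in the second,
which refers to the reversed word. -/
def Acc.extend {α : Type} (a : Acc α) (r : Bool) (l : Option (Bool × Bool)) : Acc α :=
  fun p => if p = r then
    (fun g => ((a p).1 g).or (l.bind g), fun g => (l.bind g).or ((a p).2 g)) else a p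

def Acc.Good {α : Type} (G : Set (Bool × Bool → Option α)) (a : Acc α) : Prop :=
  ∀ g ∈ G, (a false).1 g = (a true).1 g ∧ (a false).2 g = (a true).2 g

def accOf {α : Type} (N : Bool → List Bool) (u v : List Variable) : Acc α := fun p =>
  (fun g => firstVal N g (if p then v else u), fun g => firstVal N g (if p then v else u).reverse)

/-- The control states. In the state `validate` the input is parsed and moved from `src` to `dst`;
in `rewind` it is moved back, and copied to some of the stacks `name`; in `scan` it is moved to
`dst` while its variables are compared with the names at the top of the stacks `name`, whose symbols
are moved to `done`; in `restore` the latter move is undone. -/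
inductive Control (α : Type)
  | validate (p : ParseState)
  | rewind (copy : Bool → Bool)
  | scan (m : Bool → Bool) (r : Bool) (a : Acc α)
  | restore (r : Bool) (a : Acc α)

/-- The accumulator tabulates results for all assignments of values to the four labels. Over a
finite alphabet there are finitely many tables, so they fit into the control. -/
noncomputable instance {α : Type} [Finite α] : Fintype (Control α) :=
  @Fintype.ofFinite _ (Finite.of_surjective
    (Sum.elim Control.validate (Sum.elim Control.rewind (Sum.elim
      (fun x : (Bool → Bool) × Bool × Acc α => Control.scan x.1 x.2.1 x.2.2)
      (fun x : Bool × Acc α => Control.restore x.1 x.2)))) (by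
    rintro (p | c | ⟨m, r, a⟩ | ⟨r, a⟩)
    · exact ⟨.inl p, rfl⟩
    · exact ⟨.inr (.inl c), rfl⟩
    · exact ⟨.inr (.inr (.inl (m, r, a))), rfl⟩
    · exact ⟨.inr (.inr (.inr (r, a))), rfl⟩))

def acts (s d : StackAct Sym) (t e c : Bool → StackAct Sym) : Stack → StackAct Sym
  | .src => s
  | .dst => d
  | .name i => t i
  | .done i => e i
  | .cnt k => c k

abbrev keepAct : StackAct Sym := none

abbrev popAct : StackAct Sym := some none

abbrev pushAct (a : Sym) : StackAct Sym := some (some a)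

def matchLabel (m : Bool → Bool) (s : Bool) : Option (Bool × Bool) :=
  if m false then some (false, s) else if m true then some (true, s) else none

def isDigitEq (b : Bool) : Option Sym → Bool
  | some (.bit c) => b == c
  | _ => false

theorem isDigitEq_iff (b : Bool) (o : Option Sym) :
    isDigitEq b o = true ↔ o = some (.bit b) := by
  rcases o with _ | c | _ | _ | _ <;> simp [isDigitEq]
  exact eq_comm

section Machine

variable {α : Type} (cls : Bool → Option Bool) (G : Set (Bool × Bool → Option α))

-- Occurrences of the first name are counted up on the left of `≈` and down on the right; an attempt
-- to go below zero rejects.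
open Classical in
noncomputable def readMark (m : Bool → Bool) (r : Bool) (a : Acc α) (s : Bool)
    (x : Stack → Option Sym) : (Control α × (Stack → StackAct Sym)) ⊕ Bool :=
  if r = true ∧ ∃ c, (m false = true ∧ cls s = some c) ∧ x (.cnt c) = none then Sum.inr false
  else Sum.inl (.restore r (a.extend r (matchLabel m s)),
    acts popAct (pushAct (mark s)) (fun _ => keepAct) (fun _ => keepAct)
      (fun c => if m false = true ∧ cls s = some c then (if r then popAct else pushAct .plain)
        else keepAct))

open Classical in
/-- What to do after a successful scan: proceed with the next pair of suffixes of the input. -/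
noncomputable def advance (x : Stack → Option Sym) :
    (Control α × (Stack → StackAct Sym)) ⊕ Bool :=
  if x (.name true) ≠ none then
    Sum.inl (.rewind (fun _ => false),
      acts keepAct keepAct (fun i => if i then popAct else keepAct) (fun _ => keepAct)
        (fun _ => keepAct))
  else if x (.name false) ≠ none then
    Sum.inl (.rewind id,
      acts keepAct keepAct (fun i => if i then keepAct else popAct) (fun _ => keepAct)
        (fun _ => keepAct))
  else Sum.inr true

open Classical in
noncomputable def checkNext :
    Control α → (Stack → Option Sym) → (Control α × (Stack → StackAct Sym)) ⊕ Bool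
  | .validate p, x =>
    match x .src with
    | some a => Sum.inl (.validate (parseStep p a),
        acts popAct (pushAct a) (fun _ => keepAct) (fun _ => keepAct) (fun _ => keepAct))
    | none => if p = some (true, true, none) then Sum.inl (.rewind (fun _ => true), fun _ => keepAct)
        else Sum.inr false
  | .rewind copy, x =>
    match x .dst with
    | some a => Sum.inl (.rewind copy, acts (pushAct a) popAct
        (fun i => if copy i then pushAct a else keepAct) (fun _ => keepAct) (fun _ => keepAct))
    | none => Sum.inl (.scan (fun _ => true) false (accOf (fun _ => []) [] []), fun _ => keepAct)
  | .scan m r a, x =>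
    match x .src with
    | some (.bit b) => Sum.inl (.scan (fun i => m i && isDigitEq b (x (.name i))) r a,
        acts popAct (pushAct (.bit b)) (fun _ => popAct) (fun i => (x (.name i)).map some)
          (fun _ => keepAct))
    | some .approx => Sum.inl (.scan m true a,
        acts popAct (pushAct .approx) (fun _ => keepAct) (fun _ => keepAct) (fun _ => keepAct))
    | some .plain => readMark cls (fun i => m i && !isDigit (x (.name i))) r a false x
    | some .star => readMark cls (fun i => m i && !isDigit (x (.name i))) r a true x
    | none => if (∀ c, x (.cnt c) = none) ∧ a.Good G then advance x else Sum.inr false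
  | .restore r a, x =>
    if ∃ i, x (.done i) ≠ none then Sum.inl (.restore r a,
      acts keepAct keepAct (fun i => (x (.done i)).map some) (fun _ => popAct) (fun _ => keepAct))
    else Sum.inl (.scan (fun _ => true) r a, fun _ => keepAct)

noncomputable def checker : StackMachine Stack Sym (Control α) where
  input := .src
  start := .validate (some (false, false, none))
  next := checkNext cls G

def memory (src dst : List Sym) (t d : Bool → List Sym) (k : Bool → ℕ) : Stack → List Sym
  | .src => src
  | .dst => dst
  | .name i => t i
  | .done i => d i
  | .cnt c => List.replicate (k c) .plain

variable {cls G}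

theorem StackAct.apply_map_some {Γ : Type} (o : Option Γ) (l : List Γ) :
    StackAct.apply (o.map some) l = o.toList ++ l := by
  cases o <;> rfl

theorem runsTo_step {T : ℕ} {q q' : Control α} {A : Stack → StackAct Sym} {b : Bool}
    {S S' : Stack → List Sym} (h : checkNext cls G q (fun k => (S k).head?) = Sum.inl (q', A))
    (hS : ∀ k, (A k).apply (S k) = S' k) (h' : (checker cls G).RunsTo T q' S' b) :
    (checker cls G).RunsTo (T + 1) q S b := by
  refine .step h ?_
  rwa [funext hS]

theorem runsTo_restore {T : ℕ} {r : Bool} {a : Acc α} {b : Bool} {src dst : List Sym}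
    {k : Bool → ℕ} (n : ℕ) (t d : Bool → List Sym) (hd : ∀ i, (d i).length ≤ n)
    (h : (checker cls G).RunsTo T (.scan (fun _ => true) r a)
      (memory src dst (fun i => (d i).reverse ++ t i) (fun _ => []) k) b) :
    (checker cls G).RunsTo (T + n + 1) (.restore r a) (memory src dst t d k) b := by
  induction n generalizing t d with
  | zero =>
    have hd' : ∀ i, d i = [] := fun i => List.eq_nil_of_length_eq_zero (Nat.le_zero.1 (hd i))
    refine runsTo_step (q' := .scan (fun _ => true) r a) (A := fun _ => keepAct) ?_ ?_ h
    · simp [checkNext, memory, hd']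
    · rintro (_ | _ | i | i | c) <;> simp [memory, StackAct.apply, hd']
  | succ n ih =>
    by_cases he : ∃ i, d i ≠ []
    · rw [← add_assoc]
      refine runsTo_step (q' := .restore r a) (A := acts keepAct keepAct
        (fun i => (d i).head?.map some) (fun _ => popAct) (fun _ => keepAct))
        (S' := memory src dst (fun i => (d i).head?.toList ++ t i) (fun i => (d i).tail) k) ?_ ?_
        (ih _ _ (fun i => ?_) ?_)
      · simp [checkNext, memory, he]
      · rintro (_ | _ | i | i | c) <;>
          simp [memory, acts, StackAct.apply_map_some] <;> rfl
      · have := hd i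
        rw [List.length_tail]
        omega
      · have : (fun i => (d i).tail.reverse ++ ((d i).head?.toList ++ t i)) =
            fun i => (d i).reverse ++ t i := by
          funext i
          cases d i <;> simp
        rwa [this]
    · push Not at he
      refine (runsTo_step (q' := .scan (fun _ => true) r a) (A := fun _ => keepAct) ?_ ?_ h).mono
        (by omega)
      · simp [checkNext, memory, he]
      · rintro (_ | _ | i | i | c) <;> simp [memory, StackAct.apply, he]

theorem append_singleton_prefix_iff {β : Type} (l t : List β) (x : β) :
    l ++ [x] <+: t ↔ l <+: t ∧ (t.drop l.length).head? = some x := by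
  induction l generalizing t with
  | nil => cases t <;> simp [List.cons_prefix_cons, eq_comm]
  | cons y l ih => cases t <;> simp [List.cons_prefix_cons, ih, and_assoc]

-- The invariant inside a numeral: after the digits `l₀`, the flag `m i` records whether they form a
-- prefix of the stack `t i`, and as many symbols of `t i` (if present) have moved to `done`.
-- Popping goes on after a mismatch, so that both name stacks are restored in the same way.
open Classical in
theorem runsTo_scan_bits {T : ℕ} {r : Bool} {a : Acc α} {b : Bool} {src dst : List Sym}
    {k : Bool → ℕ} {t : Bool → List Sym} (l l₀ : List Bool)
    (h : (checker cls G).RunsTo T (.scan (fun i => (l₀ ++ l).map Sym.bit <+: t i) r a)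
      (memory src ((l.map Sym.bit).reverse ++ dst) (fun i => (t i).drop (l₀ ++ l).length)
        (fun i => ((t i).take (l₀ ++ l).length).reverse) k) b) :
    (checker cls G).RunsTo (T + l.length) (.scan (fun i => l₀.map Sym.bit <+: t i) r a)
      (memory (l.map Sym.bit ++ src) dst (fun i => (t i).drop l₀.length)
        (fun i => ((t i).take l₀.length).reverse) k) b := by
  induction l generalizing l₀ dst with
  | nil => simpa using h
  | cons c l ih =>
    rw [List.length_cons, ← add_assoc]
    refine runsTo_step (A := acts popAct (pushAct (.bit c)) (fun _ => popAct)
      (fun i => ((t i).drop l₀.length).head?.map some) (fun _ => keepAct)) ?_ ?_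
      (ih (l₀ ++ [c]) (dst := Sym.bit c :: dst) (by simpa using h))
    · simp only [checkNext, memory, List.map_cons, List.cons_append, List.head?_cons]
      congr 3
      funext i
      rw [Bool.eq_iff_iff, Bool.and_eq_true, isDigitEq_iff, decide_eq_true_iff, decide_eq_true_iff,
        List.map_append, List.map_singleton, append_singleton_prefix_iff, List.length_map]
    · rintro (_ | _ | i | i | c)
      · rfl
      · rfl
      · simp [memory, acts, StackAct.apply]
      · simp only [memory, acts, StackAct.apply_map_some, List.length_append, List.length_singleton]
        rw [List.take_add_one, List.reverse_append, List.head?_drop]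
        cases (t i)[l₀.length]? <;> rfl
      · rfl

theorem matchLabel_eq (N : Bool → List Bool) (t : Variable) :
    matchLabel (fun i => decide (N i = t.index.bits)) t.starred = label N t := by
  simp [matchLabel, label, eq_comm]

theorem firstVal_append (N : Bool → List Bool) (g : Bool × Bool → Option α)
    (u v : List Variable) : firstVal N g (u ++ v) = (firstVal N g u).or (firstVal N g v) := by
  simp [firstVal, List.findSome?_append]

theorem firstVal_singleton (N : Bool → List Bool) (g : Bool × Bool → Option α) (t : Variable) :
    firstVal N g [t] = (label N t).bind g := by
  cases h : (label N t).bind g <;> simp [firstVal, h]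

theorem accOf_extend_false (N : Bool → List Bool) (u v : List Variable) (t : Variable) :
    (accOf N u v : Acc α).extend false (label N t) = accOf N (u ++ [t]) v := by
  have := fun g (w : List Variable) => firstVal_append N (α := α) g [t] w
  funext p
  cases p <;> simp [Acc.extend, accOf, firstVal_append, firstVal_singleton] at this ⊢
  simp [this]

theorem accOf_extend_true (N : Bool → List Bool) (u v : List Variable) (t : Variable) :
    (accOf N u v : Acc α).extend true (label N t) = accOf N u (v ++ [t]) := by
  have := fun g (w : List Variable) => firstVal_append N (α := α) g [t] w
  funext p
  cases p <;> simp [Acc.extend, accOf, firstVal_append, firstVal_singleton] at this ⊢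
  simp [this]

theorem checkNext_mark (m : Bool → Bool) (r : Bool) (a : Acc α) (s : Bool)
    (x : Stack → Option Sym) (hx : x .src = some (mark s)) : checkNext cls G (.scan m r a) x =
      readMark cls (fun i => m i && !isDigit (x (.name i))) r a s x := by
  cases s <;> simp [checkNext, hx, mark]

theorem nameCount_append (N : List Bool) (c : Bool) (u v : List Variable) :
    nameCount cls N c (u ++ v) = nameCount cls N c u + nameCount cls N c v :=
  List.countP_append

theorem nameCount_singleton (N : List Bool) (c : Bool) (v : Variable) :
    nameCount cls N c [v] = if N = v.index.bits ∧ cls v.starred = some c then 1 else 0 := by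
  simp [nameCount, List.countP_cons, eq_comm (a := N)]

-- The hypothesis has the form used for all phases: if the test succeeds, the rest of the
-- computation has verdict `b`; otherwise `b` is `false`. Reading the mark takes one move and
-- restoring the names at most one per digit and one more.
open Classical in
theorem runsTo_scan_mark {T : ℕ} {r : Bool} {a : Acc α} {b : Bool} {src dst : List Sym}
    {k : Bool → ℕ} {t : Bool → List Sym} (v : Variable)
    (h : if r = true → ∀ c, nameCount cls (nameOf (t false)) c [v] ≤ k c then
      (checker cls G).RunsTo T
        (.scan (fun _ => true) r (a.extend r (label (fun i => nameOf (t i)) v)))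
        (memory src (mark v.starred :: dst) t (fun _ => [])
          (fun c => if r then k c - nameCount cls (nameOf (t false)) c [v]
            else k c + nameCount cls (nameOf (t false)) c [v])) b
      else b = false) :
    (checker cls G).RunsTo (T + v.index.bits.length + 2)
      (.scan (fun i => v.index.bits.map Sym.bit <+: t i) r a)
      (memory (mark v.starred :: src) dst (fun i => (t i).drop v.index.bits.length)
        (fun i => ((t i).take v.index.bits.length).reverse) k) b := by
  have hm : (fun i => decide (v.index.bits.map Sym.bit <+: t i) &&
      !isDigit ((t i).drop v.index.bits.length).head?) =
      fun i => decide (nameOf (t i) = v.index.bits) := by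
    funext i
    rw [Bool.eq_iff_iff, Bool.and_eq_true, decide_eq_true_iff, decide_eq_true_iff, nameOf_eq_iff,
      Bool.not_eq_true']
  have hnext := checkNext_mark (cls := cls) (G := G)
    (fun i => v.index.bits.map Sym.bit <+: t i) r a v.starred
    (fun i => (memory (mark v.starred :: src) dst (fun i => (t i).drop v.index.bits.length)
        (fun i => ((t i).take v.index.bits.length).reverse) k i).head?) rfl
  simp only [memory] at hnext
  rw [hm, readMark] at hnext
  -- A single variable contributes at most one, so exceeding the counter means that the counter is
  -- empty and the variable is counted.
  have hc : (r = true ∧ ∃ c, (decide (nameOf (t false) = v.index.bits) = true ∧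
      cls v.starred = some c) ∧ (List.replicate (k c) Sym.plain).head? = none) ↔
      ¬ (r = true → ∀ c, nameCount cls (nameOf (t false)) c [v] ≤ k c) := by
    push Not
    refine and_congr_right fun _ => exists_congr fun c => ?_
    rw [nameCount_singleton, decide_eq_true_iff]
    split_ifs with h1
    · simp [h1]
    · simp [h1]
  rw [if_congr hc rfl rfl] at hnext
  by_cases hr : r = true → ∀ c, nameCount cls (nameOf (t false)) c [v] ≤ k c
  · rw [if_pos hr] at h
    rw [if_neg (not_not.2 hr), matchLabel_eq] at hnext
    refine runsTo_step hnext (S' := memory src (mark v.starred :: dst)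
      (fun i => (t i).drop v.index.bits.length)
      (fun i => ((t i).take v.index.bits.length).reverse)
      (fun c => if r then k c - nameCount cls (nameOf (t false)) c [v]
            else k c + nameCount cls (nameOf (t false)) c [v])) ?_
      (runsTo_restore v.index.bits.length _ _ (fun i => by simp) ?_)
    · rintro (_ | _ | i | i | c)
      · rfl
      · rfl
      · rfl
      · rfl
      · simp only [memory, acts, decide_eq_true_iff, nameCount_singleton]
        split_ifs <;> simp [StackAct.apply, List.replicate_succ]
    · simpa using h
  · rw [if_neg hr] at h
    rw [if_pos hr] at hnext
    subst h
    exact .halt hnext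

open Classical in
theorem runsTo_scan_variable {T : ℕ} {r : Bool} {a : Acc α} {b : Bool} {src dst : List Sym}
    {k : Bool → ℕ} {t : Bool → List Sym} (v : Variable)
    (h : if r = true → ∀ c, nameCount cls (nameOf (t false)) c [v] ≤ k c then
      (checker cls G).RunsTo T
        (.scan (fun _ => true) r (a.extend r (label (fun i => nameOf (t i)) v)))
        (memory src ((encodeVariable v).reverse ++ dst) t (fun _ => [])
          (fun c => if r then k c - nameCount cls (nameOf (t false)) c [v]
            else k c + nameCount cls (nameOf (t false)) c [v])) b
      else b = false) :
    (checker cls G).RunsTo (T + 2 * (encodeVariable v).length) (.scan (fun _ => true) r a)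
      (memory (encodeVariable v ++ src) dst t (fun _ => []) k) b := by
  rw [encodeVariable_eq] at h ⊢
  have h1 := runsTo_scan_bits (cls := cls) (G := G) (T := T + v.index.bits.length + 2) (r := r)
    (a := a) (b := b) (src := mark v.starred :: src) (dst := dst) (k := k) (t := t)
    v.index.bits [] (by
      rw [List.nil_append]
      refine runsTo_scan_mark v ?_
      simpa using h)
  have h2 := h1.mono (t' := T + 2 * (v.index.bits.map Sym.bit ++ [mark v.starred]).length)
    (by simp; omega)
  simpa using h2

end Machine

end MeetStalactic

/-! ### Complete runs and the time bound -/

namespace MeetStalactic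

variable {α : Type} {cls : Bool → Option Bool} {G : Set (Bool × Bool → Option α)}

theorem accOf_nil (N N' : Bool → List Bool) : (accOf N [] [] : Acc α) = accOf N' [] [] := by
  funext p
  cases p <;> rfl

theorem encodeWord_cons (t : Variable) (u : List Variable) :
    encodeWord (t :: u) = encodeVariable t ++ encodeWord u := List.flatMap_cons

theorem runsTo_scan_left {T : ℕ} {b : Bool} {src dst : List Sym} {t : Bool → List Sym}
    (u₁ u₀ : List Variable)
    (h : (checker cls G).RunsTo T
      (.scan (fun _ => true) false (accOf (fun i => nameOf (t i)) (u₀ ++ u₁) []))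
      (memory src ((encodeWord u₁).reverse ++ dst) t (fun _ => [])
        (fun c => nameCount cls (nameOf (t false)) c (u₀ ++ u₁))) b) :
    (checker cls G).RunsTo (T + 2 * (encodeWord u₁).length)
      (.scan (fun _ => true) false (accOf (fun i => nameOf (t i)) u₀ []))
      (memory (encodeWord u₁ ++ src) dst t (fun _ => [])
        (fun c => nameCount cls (nameOf (t false)) c u₀)) b := by
  induction u₁ generalizing u₀ dst with
  | nil => simpa using h
  | cons x u₁ ih =>
    have h' := ih (u₀ ++ [x]) (dst := (encodeVariable x).reverse ++ dst) (by
      simpa [encodeWord_cons] using h)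
    rw [encodeWord_cons, List.append_assoc, List.length_append, mul_add, add_comm (2 * _),
      ← add_assoc]
    refine runsTo_scan_variable x ?_
    rw [if_pos (fun e => by cases e), accOf_extend_false]
    simpa [nameCount_append] using h'

-- The counters hold the excess of the left side over the part of the right side already read; by
-- `hle` the subtraction is a true one.
open Classical in
theorem runsTo_scan_right {T : ℕ} {b : Bool} {src dst : List Sym} {t : Bool → List Sym}
    (u v₁ v₀ : List Variable)
    (hle : ∀ c, nameCount cls (nameOf (t false)) c v₀ ≤ nameCount cls (nameOf (t false)) c u)
    (h : if ∀ c, nameCount cls (nameOf (t false)) c (v₀ ++ v₁) ≤ nameCount cls (nameOf (t false)) c u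
      then (checker cls G).RunsTo T
        (.scan (fun _ => true) true (accOf (fun i => nameOf (t i)) u (v₀ ++ v₁)))
        (memory src ((encodeWord v₁).reverse ++ dst) t (fun _ => [])
          (fun c => nameCount cls (nameOf (t false)) c u -
            nameCount cls (nameOf (t false)) c (v₀ ++ v₁))) b
      else b = false) :
    (checker cls G).RunsTo (T + 2 * (encodeWord v₁).length)
      (.scan (fun _ => true) true (accOf (fun i => nameOf (t i)) u v₀))
      (memory (encodeWord v₁ ++ src) dst t (fun _ => [])
        (fun c => nameCount cls (nameOf (t false)) c u - nameCount cls (nameOf (t false)) c v₀))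
      b := by
  induction v₁ generalizing v₀ dst with
  | nil =>
    rw [List.append_nil, if_pos hle] at h
    simpa using h
  | cons x v₁ ih =>
    rw [encodeWord_cons, List.append_assoc, List.length_append, mul_add, add_comm (2 * _),
      ← add_assoc]
    refine runsTo_scan_variable x ?_
    have hiff : (true = true → ∀ c, nameCount cls (nameOf (t false)) c [x] ≤
        nameCount cls (nameOf (t false)) c u - nameCount cls (nameOf (t false)) c v₀) ↔
        ∀ c, nameCount cls (nameOf (t false)) c (v₀ ++ [x]) ≤
          nameCount cls (nameOf (t false)) c u := by
      rw [imp_iff_right rfl]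
      refine forall_congr' fun c => ?_
      rw [nameCount_append]
      have := hle c
      omega
    rw [if_congr hiff rfl rfl]
    by_cases hx : ∀ c, nameCount cls (nameOf (t false)) c (v₀ ++ [x]) ≤
        nameCount cls (nameOf (t false)) c u
    · rw [if_pos hx, accOf_extend_true]
      have h' := ih (v₀ ++ [x]) hx (dst := (encodeVariable x).reverse ++ dst) (by
        simpa [encodeWord_cons] using h)
      simpa only [if_true, Nat.sub_sub, nameCount_append] using h'
    · rw [if_neg hx]
      -- Counts only grow, so a prefix with too many occurrences rules out the whole right side.
      rwa [if_neg] at h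
      refine fun hx' => hx fun c => ?_
      have := hx' c
      rw [← List.singleton_append, ← List.append_assoc, nameCount_append] at this
      omega

theorem checkNext_src_nil (cls : Bool → Option Bool) (r : Bool) {a : Acc α} {dst : List Sym}
    {t : Bool → List Sym} {k : Bool → ℕ} (h : (∀ c, k c = 0) ∧ a.Good G) :
    checkNext cls G (.scan (fun _ => true) r a)
      (fun i => (memory [] dst t (fun _ => []) k i).head?) =
        advance (fun i => (memory [] dst t (fun _ => []) k i).head?) :=
  if_pos ⟨fun c => by simp [memory, h.1], h.2⟩

theorem checkNext_src_nil_of_not (cls : Bool → Option Bool) (r : Bool) {a : Acc α}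
    {dst : List Sym} {t : Bool → List Sym} {k : Bool → ℕ} (h : ¬ ((∀ c, k c = 0) ∧ a.Good G)) :
    checkNext cls G (.scan (fun _ => true) r a)
      (fun i => (memory [] dst t (fun _ => []) k i).head?) = Sum.inr false :=
  if_neg fun h' => h ⟨fun c => by simpa [memory] using h'.1 c, h'.2⟩

open Classical in
/-- One scan of the identity `u ≈ v`. -/
theorem runsTo_scan {T : ℕ} {b : Bool} {t : Bool → List Sym} (u v : List Variable)
    (h : if PairOk cls G (fun i => nameOf (t i)) u v then
      (checker cls G).RunsTo T (.scan (fun _ => true) true (accOf (fun i => nameOf (t i)) u v))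
        (memory [] (encodeIdentity u v).reverse t (fun _ => []) (fun _ => 0)) b
      else b = false) :
    (checker cls G).RunsTo (T + 2 * (encodeIdentity u v).length)
      (.scan (fun _ => true) false (accOf (fun _ => []) [] []))
      (memory (encodeIdentity u v) [] t (fun _ => []) (fun _ => 0)) b := by
  have h2 : (checker cls G).RunsTo (T + 2 * (encodeWord v).length)
      (.scan (fun _ => true) true (accOf (fun i => nameOf (t i)) u []))
      (memory (encodeWord v) (Sym.approx :: (encodeWord u).reverse) t (fun _ => [])
        (fun c => nameCount cls (nameOf (t false)) c u)) b := by
    have := runsTo_scan_right (cls := cls) (G := G) (T := T) (b := b) (src := [])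
      (dst := Sym.approx :: (encodeWord u).reverse) (t := t) u v [] (fun c => Nat.zero_le _) (by
        split_ifs with hle
        · by_cases hok : PairOk cls G (fun i => nameOf (t i)) u v
          · rw [if_pos hok] at h
            have hk : (fun c => nameCount cls (nameOf (t false)) c u -
                nameCount cls (nameOf (t false)) c ([] ++ v)) = fun _ => 0 := by
              funext c
              rw [List.nil_append, hok.1 c, Nat.sub_self]
            rw [hk]
            simpa [encodeIdentity] using h
          · rw [if_neg hok] at h
            subst h
            -- A zero difference together with `hle` gives equality of the counts, so acceptance
            -- would make the pair good.
            refine .halt (checkNext_src_nil_of_not cls true fun hk => hok ⟨fun c => ?_, hk.2⟩)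
            have h1 := hk.1 c
            have h3 := hle c
            rw [List.nil_append] at h1 h3
            beta_reduce
            omega
        · rw [if_neg] at h
          · exact h
          · exact fun hok => hle fun c => (hok.1 c).ge)
    simpa [nameCount] using this
  have h1 : (checker cls G).RunsTo (T + 2 * (encodeWord v).length + 1)
      (.scan (fun _ => true) false (accOf (fun i => nameOf (t i)) u []))
      (memory (Sym.approx :: encodeWord v) (encodeWord u).reverse t (fun _ => [])
        (fun c => nameCount cls (nameOf (t false)) c u)) b := by
    refine runsTo_step rfl ?_ h2
    rintro (_ | _ | i | i | c) <;> rfl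
  have h0 := runsTo_scan_left (cls := cls) (G := G) (b := b) (t := t)
    (src := Sym.approx :: encodeWord v) (dst := []) u [] (by simpa using h1)
  have := h0.mono (t' := T + 2 * (encodeIdentity u v).length)
    (by simp [encodeIdentity]; omega)
  have he : encodeWord u ++ Sym.approx :: encodeWord v = encodeIdentity u v := by
    simp [encodeIdentity]
  rw [he, accOf_nil _ fun _ => []] at this
  exact this

theorem runsTo_rewind {T : ℕ} {b : Bool} {copy : Bool → Bool} (dst src : List Sym)
    (t : Bool → List Sym)
    (h : (checker cls G).RunsTo T (.scan (fun _ => true) false (accOf (fun _ => []) [] []))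
      (memory (dst.reverse ++ src) [] (fun i => if copy i then dst.reverse ++ t i else t i)
        (fun _ => []) (fun _ => 0)) b) :
    (checker cls G).RunsTo (T + dst.length + 1) (.rewind copy)
      (memory src dst t (fun _ => []) (fun _ => 0)) b := by
  induction dst generalizing src t with
  | nil =>
    refine runsTo_step (A := fun _ => keepAct) rfl ?_ h
    rintro (_ | _ | i | i | c) <;> simp [memory, StackAct.apply]
  | cons a dst ih =>
    refine runsTo_step (q' := .rewind copy) rfl ?_ (ih (a :: src)
      (fun i => if copy i then a :: t i else t i) ?_)
    · rintro (_ | _ | i | i | c)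
      · rfl
      · rfl
      · cases hc : copy i <;> simp [memory, acts, hc, StackAct.apply]
      · rfl
      · rfl
    · have : ∀ i, (if copy i = true then dst.reverse ++ if copy i = true then a :: t i else t i
          else if copy i = true then a :: t i else t i) =
          if copy i = true then (a :: dst).reverse ++ t i else t i := fun i => by
        split_ifs <;> simp
      simpa only [this, List.reverse_cons, List.append_assoc, List.singleton_append] using h

theorem runsTo_validate {T : ℕ} {b : Bool} (s dst : List Sym) (p : ParseState)
    (h : if s.foldl parseStep p = some (true, true, none) then
      (checker cls G).RunsTo T (.rewind (fun _ => true))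
        (memory [] (s.reverse ++ dst) (fun _ => []) (fun _ => []) (fun _ => 0)) b
      else b = false) :
    (checker cls G).RunsTo (T + s.length + 1) (.validate p)
      (memory s dst (fun _ => []) (fun _ => []) (fun _ => 0)) b := by
  induction s generalizing p dst with
  | nil =>
    by_cases hp : p = some (true, true, none)
    · rw [List.foldl_nil, if_pos hp] at h
      refine runsTo_step (A := fun _ => keepAct) (if_pos hp) ?_ h
      exact fun _ => rfl
    · rw [List.foldl_nil, if_neg hp] at h
      subst h
      exact .halt (if_neg hp)
  | cons a s ih =>
    refine runsTo_step (q' := .validate (parseStep p a)) rfl ?_ (ih (a :: dst) (parseStep p a) ?_)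
    · rintro (_ | _ | i | i | c) <;> rfl
    · simpa using h

/-- The two stacks of names. -/
def names (t₀ t₁ : List Sym) (i : Bool) : List Sym := bif i then t₁ else t₀

-- The loop over the suffixes of the second name stack. With `L` the length of the input, a round
-- costs at most `2 * L` moves for the scan, one to pop the name, and `L + 1` to rewind.
open Classical in
theorem runsTo_inner {T : ℕ} {b : Bool} (u v : List Variable) (t₀ t₁ : List Sym)
    (h : if ∀ s, s <:+ t₁ → PairOk cls G (fun i => nameOf (names t₀ s i)) u v then
      (checker cls G).RunsTo T
        (.scan (fun _ => true) true (accOf (fun i => nameOf (names t₀ [] i)) u v))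
        (memory [] (encodeIdentity u v).reverse (names t₀ []) (fun _ => []) (fun _ => 0)) b
      else b = false) :
    (checker cls G).RunsTo (T + (t₁.length + 1) * (3 * (encodeIdentity u v).length + 2))
      (.scan (fun _ => true) false (accOf (fun _ => []) [] []))
      (memory (encodeIdentity u v) [] (names t₀ t₁) (fun _ => []) (fun _ => 0)) b := by
  induction t₁ with
  | nil =>
    refine (runsTo_scan (T := T) u v ?_).mono (by simp; omega)
    split_ifs with hok
    · rwa [if_pos] at h
      intro s hs
      rwa [List.suffix_nil.1 hs]
    · rwa [if_neg] at h
      exact fun h' => hok (h' [] List.suffix_rfl)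
  | cons a t₁ ih =>
    rw [List.length_cons, add_mul _ 1, one_mul]
    refine (runsTo_scan (T := T + (t₁.length + 1) * (3 * (encodeIdentity u v).length + 2) +
      (encodeIdentity u v).length + 1 + 1) u v ?_).mono (by omega)
    split_ifs with hok
    · refine runsTo_step (checkNext_src_nil cls true (a := accOf _ u v) ⟨fun _ => rfl, hok.2⟩)
        (S' := memory [] (encodeIdentity u v).reverse (names t₀ t₁) (fun _ => []) (fun _ => 0)) ?_
        ((runsTo_rewind (cls := cls) (G := G) (copy := fun _ => false)
          (encodeIdentity u v).reverse [] (names t₀ t₁)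
          (T := T + (t₁.length + 1) * (3 * (encodeIdentity u v).length + 2)) ?_).mono (by simp))
      · rintro (_ | _ | (_ | _) | i | c) <;> rfl
      · simp only [List.reverse_reverse, List.append_nil, Bool.false_eq_true, if_false]
        refine ih ?_
        refine (if_congr (forall_congr' fun s => ?_) rfl rfl).mp h
        rw [List.suffix_cons_iff]
        exact ⟨fun h' hs => h' (Or.inr hs), fun h' hs => hs.elim (fun e => e ▸ hok) h'⟩
    · rwa [if_neg] at h
      exact fun h' => hok (h' _ List.suffix_rfl)

-- The loop over the suffixes of the first name stack. The rewind that begins a new round (`copy :=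
-- id`) also refills the second name stack, which the inner loop has emptied.
open Classical in
theorem runsTo_outer (u v : List Variable) (t₀ : List Sym) :
    (checker cls G).RunsTo ((t₀.length + 1) * (((encodeIdentity u v).length + 1) *
      (3 * (encodeIdentity u v).length + 2) + (encodeIdentity u v).length + 2))
      (.scan (fun _ => true) false (accOf (fun _ => []) [] []))
      (memory (encodeIdentity u v) [] (names t₀ (encodeIdentity u v)) (fun _ => []) (fun _ => 0))
      (decide (∀ s, s <:+ t₀ → ∀ s', s' <:+ encodeIdentity u v →
        PairOk cls G (fun i => nameOf (names s s' i)) u v)) := by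
  induction t₀ with
  | nil =>
    refine (runsTo_inner (T := 0) u v [] (encodeIdentity u v) ?_).mono (by simp; omega)
    split_ifs with hok
    · have : decide (∀ s, s <:+ [] → ∀ s', s' <:+ encodeIdentity u v →
          PairOk cls G (fun i => nameOf (names s s' i)) u v) = true :=
        decide_eq_true fun s hs => by rwa [List.suffix_nil.1 hs]
      rw [this]
      exact .halt (checkNext_src_nil cls true (a := accOf _ u v)
        ⟨fun _ => rfl, (hok [] List.nil_suffix).2⟩)
    · exact decide_eq_false fun h' => hok (h' [] List.suffix_rfl)
  | cons a t₀ ih =>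
    set s₀ := encodeIdentity u v with hs₀
    set C := (s₀.length + 1) * (3 * s₀.length + 2) with hC
    refine (runsTo_inner (T := (t₀.length + 1) * (C + s₀.length + 2) + s₀.length + 1 + 1) u v
      (a :: t₀) s₀ ?_).mono ?_
    · split_ifs with hok
      · refine runsTo_step (checkNext_src_nil cls true (a := accOf _ u v)
          ⟨fun _ => rfl, (hok [] List.nil_suffix).2⟩)
          (S' := memory [] s₀.reverse (names t₀ []) (fun _ => []) (fun _ => 0)) ?_
          ((runsTo_rewind (cls := cls) (G := G) (copy := id) s₀.reverse [] (names t₀ [])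
            (T := (t₀.length + 1) * (C + s₀.length + 2)) ?_).mono (by simp))
        · rintro (_ | _ | (_ | _) | i | c) <;> rfl
        · have hn : (fun i => if id i = true then s₀.reverse.reverse ++ names t₀ [] i
              else names t₀ [] i) = names t₀ s₀ := by
            funext i
            cases i <;> simp [names]
          rw [hn, List.reverse_reverse, List.append_nil]
          have hd : (∀ s, s <:+ a :: t₀ → ∀ s', s' <:+ s₀ →
              PairOk cls G (fun i => nameOf (names s s' i)) u v) ↔
              ∀ s, s <:+ t₀ → ∀ s', s' <:+ s₀ →
                PairOk cls G (fun i => nameOf (names s s' i)) u v := by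
            refine forall_congr' fun s => ?_
            rw [List.suffix_cons_iff]
            exact ⟨fun h' hs => h' (Or.inr hs), fun h' hs => hs.elim (fun e => e ▸ hok) h'⟩
          rw [decide_eq_decide.2 hd]
          exact ih
      · exact decide_eq_false fun h' => hok (h' _ List.suffix_rfl)
    · rw [List.length_cons, add_mul (t₀.length + 1) 1, one_mul, ← hs₀, ← hC]
      omega

open Classical in
theorem runsTo_checker (s : List Sym) :
    (checker cls G).RunsTo ((s.length + 1) + (s.length + 1) + (s.length + 1) * ((s.length + 1) *
      (3 * s.length + 2) + s.length + 2)) (checker cls G).start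
      (fun k => if k = (checker cls G).input then s else [])
      (decide (∃ u v : List Variable, u ≠ [] ∧ v ≠ [] ∧ s = encodeIdentity u v ∧
        ∀ s₀, s₀ <:+ s → ∀ s₁, s₁ <:+ s →
          PairOk cls G (fun i => nameOf (names s₀ s₁ i)) u v)) := by
  have hstart : (fun k => if k = (checker cls G).input then s else []) =
      memory s [] (fun _ => []) (fun _ => []) (fun _ => 0) := by
    funext k
    cases k <;> simp [checker, memory]
  rw [hstart]
  refine (runsTo_validate (cls := cls) (G := G) s [] _ (T := (s.length + 1) + (s.length + 1) *
    ((s.length + 1) * (3 * s.length + 2) + s.length + 2)) ?_).mono (by omega)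
  split_ifs with hs
  -- Choosing a decoding that passes the test whenever there is one makes injectivity of the
  -- encoding unnecessary.
  · obtain ⟨u, v, hu, hv, hsuv, hb⟩ : ∃ u v : List Variable, u ≠ [] ∧ v ≠ [] ∧
        s = encodeIdentity u v ∧ ((∃ u v : List Variable, u ≠ [] ∧ v ≠ [] ∧ s = encodeIdentity u v ∧
          ∀ s₀, s₀ <:+ s → ∀ s₁, s₁ <:+ s → PairOk cls G (fun i => nameOf (names s₀ s₁ i)) u v) ↔
        ∀ s₀, s₀ <:+ s → ∀ s₁, s₁ <:+ s →
          PairOk cls G (fun i => nameOf (names s₀ s₁ i)) u v) := by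
      by_cases h : ∃ u v : List Variable, u ≠ [] ∧ v ≠ [] ∧ s = encodeIdentity u v ∧
          ∀ s₀, s₀ <:+ s → ∀ s₁, s₁ <:+ s → PairOk cls G (fun i => nameOf (names s₀ s₁ i)) u v
      · obtain ⟨u, v, hu, hv, hsuv, h'⟩ := h
        exact ⟨u, v, hu, hv, hsuv, fun _ => h', fun _ => ⟨u, v, hu, hv, hsuv, h'⟩⟩
      · obtain ⟨u, v, hu, hv, hsuv⟩ := (foldl_parseStep_eq_iff s).1 hs
        exact ⟨u, v, hu, hv, hsuv, fun h' => absurd h' h, fun h' => ⟨u, v, hu, hv, hsuv, h'⟩⟩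
    rw [decide_eq_decide.2 hb]
    have := runsTo_outer (cls := cls) (G := G) u v s
    rw [← hsuv] at this
    refine (runsTo_rewind (cls := cls) (G := G) (copy := fun _ => true) (s.reverse ++ []) [] _
      (T := (s.length + 1) * ((s.length + 1) * (3 * s.length + 2) + s.length + 2)) ?_).mono
      (by simp; omega)
    have hn : (fun i : Bool => if true = true then (s.reverse ++ []).reverse ++ [] else []) =
        names s s := by
      funext i
      cases i <;> simp [names]
    rw [hn, List.append_nil, List.append_nil, List.reverse_reverse]
    exact this
  · exact decide_eq_false fun ⟨u, v, hu, hv, hsuv, _⟩ =>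
      hs ((foldl_parseStep_eq_iff s).2 ⟨u, v, hu, hv, hsuv⟩)

/-- Suffixes may also name strings that are no variables of the identity, for instance truncated
numerals. This is harmless, because a valid identity satisfies `PairOk` for arbitrary names. -/
theorem mem_checkId_iff {n : ℕ} (σ : Equiv.Perm (Fin n)) (hσ : σ * σ = 1) (s : List Sym) :
    s ∈ CheckId (involution σ hσ) ↔
      ∃ u v : List Variable, u ≠ [] ∧ v ≠ [] ∧ s = encodeIdentity u v ∧
        ∀ s₀, s₀ <:+ s → ∀ s₁, s₁ <:+ s →
          PairOk (countClass σ) (patterns σ) (fun i => nameOf (names s₀ s₁ i)) u v := by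
  refine exists_congr fun u => exists_congr fun v => and_congr_right fun hu =>
    and_congr_right fun hv => and_congr_right fun hs => ⟨fun h s₀ _ s₁ _ =>
      pairOk_of_satisfies σ hσ h _, fun h => satisfies_of_pairOk σ hσ hu hv fun x hx y hy => ?_⟩
  subst hs
  obtain ⟨s₀, hs₀, hx'⟩ := exists_suffix_of_mem hx
  obtain ⟨s₁, hs₁, hy'⟩ := exists_suffix_of_mem hy
  have := h s₀ hs₀ s₁ hs₁
  have he : (fun i => nameOf (names s₀ s₁ i)) =
      fun i => Nat.bits (bif i then y.index else x.index) := by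
    funext i
    cases i
    · exact hx'
    · exact hy'
  rwa [he] at this

theorem checkId_mem_classP {n : ℕ} (σ : Equiv.Perm (Fin n)) (hσ : σ * σ = 1) :
    CheckId (involution σ hσ) ∈ ClassP Sym := by
  classical
  refine StackMachine.mem_classP (checker (countClass σ) (patterns σ)) _ _
    (fun s => decide_eq_true_iff.trans (mem_checkId_iff σ hσ s).symm)
    (.X + 1 + (.X + 1) + (.X + 1) * ((.X + 1) * (3 * .X + 2) + .X + 2)) (fun s => ?_)
  have := runsTo_checker (cls := countClass σ) (G := patterns σ) s
  simpa using this

end MeetStalactic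

theorem corollary4p5 (n i : ℕ) (σ : Equiv.Perm (Fin n))
    (hσ : σ.cycleType = Multiset.replicate i 2) :
    MeetStalactic.CheckId
      (MeetStalactic.involution σ (MeetStalactic.mul_self_of_cycleType hσ)) ∈
        MeetStalactic.ClassP MeetStalactic.Sym :=
  MeetStalactic.checkId_mem_classP σ _
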